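/- Let $(M,g)$ be a two-dimensional smooth manifold (Hausdorff, second countable, without boundary) with a Riemannian metric $g$ of class $C^2$, and let $\mathrm{vol}$, $\nabla$, $\mathrm{Hess}$, $\Delta=\mathrm{tr}_g\,\mathrm{Hess}$ denote its Riemannian volume, gradient, Hessian (for the Levi-Civita connection) and Laplace–Beltrami operator. Let $\varepsilon>0$. Then there exist a smooth function $f\colon M\to\mathbb R$, an open set $V\subset M$ and constants $C>0$, $\alpha\in\mathbb R$ and $c>0$ such that 1. $\mathrm{vol}(M)\le \mathrm{vol}(V)+\varepsilon$, that is, $\mathrm{vol}(V)\ge \mathrm{vol}(M)-\varepsilon$; 2. for every $T>0$ and every $u\in H^1((0,T)\times M)$, with weak time derivative $u_t$ and weak spatial Riemannian gradient $\nabla u$, the integrand on the right-hand side below is integrable on $(0,T)\times V$ and $$C\int_0^T\!\!\int_V \left(|\nabla u|^2+u_t^2\right)d\mathrm{vol}\,dt\ \le\ \int_0^T\!\!\int_V\left[\mathrm{Hess} f(\nabla u,\nabla u)+\left(\alpha-\frac{\Delta f}{2}\right)|\nabla u|^2+\left(\frac{\Delta f}{2}-\alpha\right)u_t^2\right]d\mathrm{vol}\,dt;$$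 3. $|\nabla f(x)|\ge c$ for every $x\in V$, that is, $\inf_{x\in V}|\nabla f(x)|>0$. -/

import Mathlib

open Set MeasureTheory Bundle
open scoped Manifold ContDiff ENNReal

namespace Riem

noncomputable section

section Definitions

variable {n : ℕ} {M : Type*} [TopologicalSpace M] [ChartedSpace (EuclideanSpace ℝ (Fin n)) M]

/-- The coordinate vector field `∂ᵢ` of the chart `φ`, at the point with coordinates `y`. -/
def coordVec (φ : OpenPartialHomeomorph M (EuclideanSpace ℝ (Fin n)))
    (y : EuclideanSpace ℝ (Fin n)) (i : Fin n) : TangentSpace (𝓡 n) (φ.symm y) :=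
  mfderiv (𝓡 n) (𝓡 n) φ.symm y (EuclideanSpace.single i (1 : ℝ))

/-- The partial derivative `∂F/∂yᵢ` of a function of the coordinates. -/
def pderiv (i : Fin n) (F : EuclideanSpace ℝ (Fin n) → ℝ) (y : EuclideanSpace ℝ (Fin n)) : ℝ :=
  fderiv ℝ F y (EuclideanSpace.single i (1 : ℝ))

/-- The `i`-th component `vⁱ` of a tangent vector `v = ∑ vⁱ ∂ᵢ` in the chart `φ`. -/
def component (φ : OpenPartialHomeomorph M (EuclideanSpace ℝ (Fin n))) {x : M}
    (v : TangentSpace (𝓡 n) x) (i : Fin n) : ℝ :=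
  (show EuclideanSpace ℝ (Fin n) from mfderiv (𝓡 n) (𝓡 n) φ x v) i

/-- The coordinate expression `∂²f/∂yᵢ∂yⱼ` of second partial derivatives in the chart `φ`. -/
def secondPartial (f : M → ℝ) (φ : OpenPartialHomeomorph M (EuclideanSpace ℝ (Fin n)))
    (y : EuclideanSpace ℝ (Fin n)) (i j : Fin n) : ℝ :=
  pderiv i (pderiv j (f ∘ φ.symm)) y

variable [RiemannianBundle (fun x : M => TangentSpace (𝓡 n) x)]

/-- The matrix `(gᵢⱼ)` of the Riemannian metric in the chart `φ`. -/
def metricMatrix (φ : OpenPartialHomeomorph M (EuclideanSpace ℝ (Fin n)))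
    (y : EuclideanSpace ℝ (Fin n)) : Matrix (Fin n) (Fin n) ℝ :=
  Matrix.of fun i j => inner ℝ (coordVec φ y i) (coordVec φ y j)

/-- The Christoffel symbol `Γᵏᵢⱼ = ½ ∑ₗ gᵏˡ (∂ᵢ gⱼₗ + ∂ⱼ gᵢₗ - ∂ₗ gᵢⱼ)` of the Levi-Civita
connection in the chart `φ`. -/
def christoffel (φ : OpenPartialHomeomorph M (EuclideanSpace ℝ (Fin n)))
    (y : EuclideanSpace ℝ (Fin n)) (k i j : Fin n) : ℝ :=
  (1 / 2 : ℝ) * ∑ l, (metricMatrix φ y)⁻¹ k l *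
    (pderiv i (fun z => metricMatrix φ z j l) y
      + pderiv j (fun z => metricMatrix φ z i l) y
      - pderiv l (fun z => metricMatrix φ z i j) y)

/-- `Hess f (∂ᵢ, ∂ⱼ) = ∂²f/∂yᵢ∂yⱼ - ∑ₖ Γᵏᵢⱼ ∂f/∂yₖ` in the chart `φ`. -/
def hessMatrix (f : M → ℝ) (φ : OpenPartialHomeomorph M (EuclideanSpace ℝ (Fin n)))
    (y : EuclideanSpace ℝ (Fin n)) (i j : Fin n) : ℝ :=
  secondPartial f φ y i j - ∑ k, christoffel φ y k i j * pderiv k (f ∘ φ.symm) y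

/-- The Hessian `Hess f (v, w)` at `x`. The expression does not depend on the chart around `x`
for a `C²` function, and the preferred chart at `x` is used. -/
def hess (f : M → ℝ) (x : M) (v w : TangentSpace (𝓡 n) x) : ℝ :=
  ∑ i, ∑ j,
    hessMatrix f (chartAt (EuclideanSpace ℝ (Fin n)) x)
      (chartAt (EuclideanSpace ℝ (Fin n)) x x) i j
      * component (chartAt (EuclideanSpace ℝ (Fin n)) x) v i
      * component (chartAt (EuclideanSpace ℝ (Fin n)) x) w j

variable (n) in
/-- The Laplace-Beltrami operator: the trace `∑ gⁱʲ Hess f (∂ᵢ, ∂ⱼ)` of the Hessian. -/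
def laplacian (f : M → ℝ) (x : M) : ℝ :=
  ∑ i, ∑ j,
    (metricMatrix (chartAt (EuclideanSpace ℝ (Fin n)) x)
      (chartAt (EuclideanSpace ℝ (Fin n)) x x))⁻¹ i j
    * hessMatrix f (chartAt (EuclideanSpace ℝ (Fin n)) x)
      (chartAt (EuclideanSpace ℝ (Fin n)) x x) i j

variable (n) in
/-- The Riemannian gradient: the tangent vector `∇f` with `⟪∇f, v⟫ = df(v)` for all `v`. -/
def grad (f : M → ℝ) (x : M) : TangentSpace (𝓡 n) x :=
  haveI : FiniteDimensional ℝ (TangentSpace (𝓡 n) x) :=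
    inferInstanceAs (FiniteDimensional ℝ (EuclideanSpace ℝ (Fin n)))
  haveI : CompleteSpace (TangentSpace (𝓡 n) x) := FiniteDimensional.complete ℝ _
  (InnerProductSpace.toDual ℝ (TangentSpace (𝓡 n) x)).symm (mvfderiv (𝓡 n) f x)

variable [MeasurableSpace M]

/-- The measure `√(det gᵢⱼ) dy` of the chart `φ`, transported to `M`; it lives on the domain of
`φ`. -/
def chartVol (φ : OpenPartialHomeomorph M (EuclideanSpace ℝ (Fin n))) : Measure M :=
  ((volume.restrict φ.target).withDensity
    fun y => ENNReal.ofReal (√(metricMatrix φ y).det)).map φ.symm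

variable (n M) in
/-- The Riemannian volume measure. Any two of the measures `chartVol φ` agree on the common domain
of the charts; the volume measure is the one that they patch together to. Since countably many
charts cover `M`, it is the least measure that dominates all of them. -/
def vol : Measure M :=
  ⨆ φ ∈ atlas (EuclideanSpace ℝ (Fin n)) M, chartVol φ

/-- `u` belongs to the Sobolev space `H¹((0,T) × M)`, and `ut` and `du` are its weak time
derivative `∂u/∂t` and its weak (spatial) Riemannian gradient `∇u`. Weak derivatives are tested
in charts: the spatial partial derivative `∂u/∂yᵢ` is `⟪∇u, ∂ᵢ⟫`. -/
structure IsH1 [IsManifold (𝓡 n) 1 M] (T : ℝ) (u : ℝ × M → ℝ) (ut : ℝ × M → ℝ)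
    (du : (z : ℝ × M) → TangentSpace (𝓡 n) z.2) : Prop where
  memLp_fun : MemLp u 2 ((volume.restrict (Ioo 0 T)).prod (vol n M))
  memLp_time : MemLp ut 2 ((volume.restrict (Ioo 0 T)).prod (vol n M))
  aestronglyMeasurable_grad :
    AEStronglyMeasurable (fun z => (⟨z.2, du z⟩ : TangentBundle (𝓡 n) M))
      ((volume.restrict (Ioo 0 T)).prod (vol n M))
  integrable_grad :
    Integrable (fun z => ‖du z‖ ^ 2) ((volume.restrict (Ioo 0 T)).prod (vol n M))
  weak_time : ∀ φ ∈ atlas (EuclideanSpace ℝ (Fin n)) M,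
    ∀ ψ : ℝ × EuclideanSpace ℝ (Fin n) → ℝ, ContDiff ℝ ∞ ψ → HasCompactSupport ψ →
      tsupport ψ ⊆ Ioo 0 T ×ˢ φ.target →
      ∫ z, u (z.1, φ.symm z.2) * fderiv ℝ ψ z (1, 0)
        = - ∫ z, ut (z.1, φ.symm z.2) * ψ z
  weak_space : ∀ φ ∈ atlas (EuclideanSpace ℝ (Fin n)) M,
    ∀ ψ : ℝ × EuclideanSpace ℝ (Fin n) → ℝ, ContDiff ℝ ∞ ψ → HasCompactSupport ψ →
      tsupport ψ ⊆ Ioo 0 T ×ˢ φ.target → ∀ i : Fin n,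
      ∫ z, u (z.1, φ.symm z.2) * fderiv ℝ ψ z (0, EuclideanSpace.single i (1 : ℝ))
        = - ∫ z, inner ℝ (du (z.1, φ.symm z.2)) (coordVec φ z.2 i) * ψ z

/-- The multiplier inequality on `(0,T) × V` for the multiplier `f`, with constants `C` and `α`,
for a function with time derivative `ut` and gradient `du`:
`C ∫₀ᵀ∫_V (|∇u|² + uₜ²) ≤ ∫₀ᵀ∫_V [Hess f (∇u,∇u) + (α - Δf/2) |∇u|² + (Δf/2 - α) uₜ²]`,
where the integral on the right converges absolutely. -/
def MultiplierInequality (f : M → ℝ) (V : Set M) (C α T : ℝ) (ut : ℝ × M → ℝ)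
    (du : (z : ℝ × M) → TangentSpace (𝓡 n) z.2) : Prop :=
  IntegrableOn (fun z : ℝ × M => hess f z.2 (du z) (du z)
      + (α - laplacian n f z.2 / 2) * ‖du z‖ ^ 2
      + (laplacian n f z.2 / 2 - α) * ut z ^ 2) (Ioo 0 T ×ˢ V) (volume.prod (vol n M)) ∧
  C * ∫ z in Ioo 0 T ×ˢ V, (‖du z‖ ^ 2 + ut z ^ 2) ∂(volume.prod (vol n M))
    ≤ ∫ z in Ioo 0 T ×ˢ V, (hess f z.2 (du z) (du z)
      + (α - laplacian n f z.2 / 2) * ‖du z‖ ^ 2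
      + (laplacian n f z.2 / 2 - α) * ut z ^ 2) ∂(volume.prod (vol n M))

end Definitions

end

end Riem

/-!
In dimension two the quadratic form `Hess f - (Δf / 2) g` is trace free, so the integrand of the
multiplier inequality is positive as soon as `Hess f` is close to the metric `g`: if `Hess f` is
within `g / 4` of `g`, then `Hess f ≥ 3/4` and `3/4 ≤ Δf / 2 ≤ 5/4`, and `α = 5/8` makes the
coefficients of `|∇u|²` and of `uₜ²` at least `1/8`. The inequality then holds pointwise on `V`
(`multiplierInequality_of_isAdapted`). It only uses the square integrability of `uₜ` and `∇u`.

It remains to find `f` with `Hess f` close to `g` and `|∇f| ≥ 1/2` on a large open set. Gradient and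
Hessian of a function can be prescribed freely at one point, so that each point has a neighbourhood
`U` and a smooth function on `U` with both properties there (`exists_isAdapted_nhds`). The constants
do not depend on the point, hence functions of this kind may be used simultaneously on infinitely
many disjoint sets. `M` is covered by countably many such neighbourhoods, and a locally finite
family of disjoint closed sets subordinate to the cover has interiors with union `V` of almost full
volume (`exists_disjoint_closed_almost_cover`). A partition of unity argument extends the local
functions from these closed sets to a global `f` (`exists_contMDiff_eqOn_of_disjoint`).

Two facts make the coordinate definitions usable. The Hessian at `x` is computed in the preferred
chart at `x`, which varies with `x` without any continuity; the transformation law of the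
Christoffel symbols (`christoffel_pullback`) shows that every chart gives the same value
(`hessForm_transition`), so that Hessian and Laplacian are continuous. The volume is a supremum over
the whole atlas; by the change of variables formula the chart measures agree on overlaps
(`chartVol_eq_of_subset`), so that the volume is locally finite
(`isLocallyFiniteMeasure_vol`) and inner regularity is available.
-/

namespace Riem

/-! ### The Koszul expression under a change of coordinates -/

section Koszul

open Filter Topology

variable {E : Type*} [NormedAddCommGroup E] [NormedSpace ℝ E]

/-- Twice the Christoffel symbol of the first kind, `∂ᵤ b(v,w) + ∂ᵥ b(u,w) - ∂_w b(u,v)`, for a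
field `b` of bilinear forms on a normed space and constant vectors `u`, `v`, `w`. -/
noncomputable def koszul (b : E → E →L[ℝ] E →L[ℝ] ℝ) (y u v w : E) : ℝ :=
  fderiv ℝ b y u v w + fderiv ℝ b y v u w - fderiv ℝ b y w u v

variable {b b' : E → E →L[ℝ] E →L[ℝ] ℝ} {τ : E → E} {y : E}

set_option synthInstance.maxHeartbeats 100000 in
/-- The derivative of a pulled back bilinear form, by the product rule. -/
theorem fderiv_pullback_apply (hb' : DifferentiableAt ℝ b' (τ y)) (hτ : ContDiffAt ℝ 2 τ y)
    (h : ∀ᶠ z in 𝓝 y, b z = (b' (τ z)).bilinearComp (fderiv ℝ τ z) (fderiv ℝ τ z))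
    (u v w : E) :
    DifferentiableAt ℝ b y → fderiv ℝ b y u v w =
      fderiv ℝ b' (τ y) (fderiv ℝ τ y u) (fderiv ℝ τ y v) (fderiv ℝ τ y w)
        + b' (τ y) (fderiv ℝ (fderiv ℝ τ) y u v) (fderiv ℝ τ y w)
        + b' (τ y) (fderiv ℝ τ y v) (fderiv ℝ (fderiv ℝ τ) y u w) := by
  intro hb
  have hD : HasFDerivAt (fderiv ℝ τ) (fderiv ℝ (fderiv ℝ τ) y) y :=
    ((hτ.fderiv_right (m := 1) (by norm_num)).differentiableAt one_ne_zero).hasFDerivAt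
  have hτ' : HasFDerivAt τ (fderiv ℝ τ y) y :=
    (hτ.differentiableAt (by norm_num)).hasFDerivAt
  have hc : HasFDerivAt (fun z => b' (τ z)) ((fderiv ℝ b' (τ y)).comp (fderiv ℝ τ y)) y :=
    HasFDerivAt.comp (g := b') y hb'.hasFDerivAt hτ'
  have h1 := (hc.clm_apply (hD.clm_apply (hasFDerivAt_const v y))).clm_apply
    (hD.clm_apply (hasFDerivAt_const w y))
  have h2 := (hb.hasFDerivAt.clm_apply (hasFDerivAt_const v y)).clm_apply (hasFDerivAt_const w y)
  have h3 : (fun z => b z v w) =ᶠ[𝓝 y]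
      fun z => b' (τ z) (fderiv ℝ τ z v) (fderiv ℝ τ z w) := by
    filter_upwards [h] with z hz
    rw [hz]; rfl
  have h4 := congrArg (fun L => L u) (h2.unique (h1.congr_of_eventuallyEq h3))
  simpa [add_comm, add_left_comm, add_assoc] using h4

/-- The Koszul expression is not tensorial: pulling back by `τ` produces the second derivative of
`τ`. -/
theorem koszul_pullback (hb : DifferentiableAt ℝ b y) (hb' : DifferentiableAt ℝ b' (τ y))
    (hτ : ContDiffAt ℝ 2 τ y) (hsymm : ∀ u v, b' (τ y) u v = b' (τ y) v u)
    (h : ∀ᶠ z in 𝓝 y, b z = (b' (τ z)).bilinearComp (fderiv ℝ τ z) (fderiv ℝ τ z))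
    (u v w : E) :
    koszul b y u v w = koszul b' (τ y) (fderiv ℝ τ y u) (fderiv ℝ τ y v) (fderiv ℝ τ y w)
      + 2 * b' (τ y) (fderiv ℝ (fderiv ℝ τ) y u v) (fderiv ℝ τ y w) := by
  have hS := hτ.isSymmSndFDerivAt (by simp)
  have hf := fun u v w => fderiv_pullback_apply hb' hτ h u v w hb
  rw [koszul, koszul, hf, hf, hf, hS.eq v u, hS.eq w v, hS.eq w u,
    hsymm (fderiv ℝ τ y v), hsymm (fderiv ℝ τ y u)]
  ring

/-- The transformation law of the Christoffel symbols: `Γ` and `Γ'` are the vectors dual to half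
the Koszul expressions of the two metrics. -/
theorem christoffel_pullback {Γ Γ' : E → E → E} (hb : DifferentiableAt ℝ b y)
    (hb' : DifferentiableAt ℝ b' (τ y)) (hτ : ContDiffAt ℝ 2 τ y)
    (hsymm : ∀ u v, b' (τ y) u v = b' (τ y) v u)
    (hnd : ∀ u, (∀ w, b' (τ y) u w = 0) → u = 0)
    (hsurj : Function.Surjective (fderiv ℝ τ y))
    (h : ∀ᶠ z in 𝓝 y, b z = (b' (τ z)).bilinearComp (fderiv ℝ τ z) (fderiv ℝ τ z))
    (hΓ : ∀ u v w, b y (Γ u v) w = koszul b y u v w / 2)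
    (hΓ' : ∀ u v w, b' (τ y) (Γ' u v) w = koszul b' (τ y) u v w / 2) (u v : E) :
    fderiv ℝ τ y (Γ u v) =
      Γ' (fderiv ℝ τ y u) (fderiv ℝ τ y v) + fderiv ℝ (fderiv ℝ τ) y u v := by
  rw [← sub_eq_zero]
  refine hnd _ fun w => ?_
  obtain ⟨w, rfl⟩ := hsurj w
  have h1 : b y (Γ u v) w = b' (τ y) (fderiv ℝ τ y (Γ u v)) (fderiv ℝ τ y w) := by
    rw [h.self_of_nhds]; rfl
  rw [map_sub, map_add, sub_apply, add_apply, ← h1, hΓ,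
    hΓ', koszul_pullback hb hb' hτ hsymm h]
  ring

/-- The covariant second derivative `D²F(u,v) - DF(Γ(u,v))` is tensorial: the second derivative
of `τ` cancels between the two terms. -/
theorem hessian_pullback {Γ Γ' : E → E → E} {F F' : E → ℝ}
    (hF' : ContDiffAt ℝ 2 F' (τ y)) (hτ : ContDiffAt ℝ 2 τ y) (hF : F =ᶠ[𝓝 y] F' ∘ τ)
    (hΓ : ∀ u v, fderiv ℝ τ y (Γ u v) =
      Γ' (fderiv ℝ τ y u) (fderiv ℝ τ y v) + fderiv ℝ (fderiv ℝ τ) y u v) (u v : E) :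
    fderiv ℝ (fderiv ℝ F) y u v - fderiv ℝ F y (Γ u v) =
      fderiv ℝ (fderiv ℝ F') (τ y) (fderiv ℝ τ y u) (fderiv ℝ τ y v)
        - fderiv ℝ F' (τ y) (Γ' (fderiv ℝ τ y u) (fderiv ℝ τ y v)) := by
  have hD : HasFDerivAt (fderiv ℝ τ) (fderiv ℝ (fderiv ℝ τ) y) y :=
    ((hτ.fderiv_right (m := 1) (by norm_num)).differentiableAt one_ne_zero).hasFDerivAt
  have hτ' : HasFDerivAt τ (fderiv ℝ τ y) y :=
    (hτ.differentiableAt (by norm_num)).hasFDerivAt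
  have hDF : HasFDerivAt (fderiv ℝ F') (fderiv ℝ (fderiv ℝ F') (τ y)) (τ y) :=
    ((hF'.fderiv_right (m := 1) (by norm_num)).differentiableAt one_ne_zero).hasFDerivAt
  have h1 : fderiv ℝ F =ᶠ[𝓝 y] fun z => (fderiv ℝ F' (τ z)).comp (fderiv ℝ τ z) := by
    have e1 : ∀ᶠ z in 𝓝 y, DifferentiableAt ℝ F' (τ z) :=
      hτ'.continuousAt.eventually ((hF'.eventually (by simp)).mono
        fun z hz => hz.differentiableAt (by norm_num))
    have e2 : ∀ᶠ z in 𝓝 y, DifferentiableAt ℝ τ z :=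
      (hτ.eventually (by simp)).mono fun z hz => hz.differentiableAt (by norm_num)
    filter_upwards [hF.eventuallyEq_nhds, e1, e2] with z hz h1 h2
    rw [hz.fderiv_eq, fderiv_comp z h1 h2]
  have h2 := (hDF.comp y hτ').clm_comp hD
  have h3 : fderiv ℝ (fderiv ℝ F) y u v =
      fderiv ℝ (fderiv ℝ F') (τ y) (fderiv ℝ τ y u) (fderiv ℝ τ y v)
        + fderiv ℝ F' (τ y) (fderiv ℝ (fderiv ℝ τ) y u v) := by
    have := congrArg (fun L => L u v) (h2.congr_of_eventuallyEq h1).fderiv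
    simpa [add_comm] using this
  rw [h3, h1.self_of_nhds, ContinuousLinearMap.comp_apply, hΓ, map_add]
  ring

end Koszul

/-! ### The metric in a chart -/

section MetricForm

open Filter Topology

theorem inner_map_eq_sum {n : ℕ} {W : Type*} [NormedAddCommGroup W] [InnerProductSpace ℝ W]
    (L : EuclideanSpace ℝ (Fin n) →ₗ[ℝ] W) (u v : EuclideanSpace ℝ (Fin n)) :
    inner ℝ (L u) (L v) = ∑ i, ∑ j, inner ℝ (L (EuclideanSpace.single i 1))
      (L (EuclideanSpace.single j 1)) * (u i * v j) := by
  have h : ∀ w : EuclideanSpace ℝ (Fin n), L w = ∑ i, w i • L (EuclideanSpace.single i 1) := by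
    intro w
    conv_lhs => rw [← (EuclideanSpace.basisFun (Fin n) ℝ).sum_repr w, map_sum]
    simp
  rw [h u, h v, sum_inner]
  refine Finset.sum_congr rfl fun i _ => ?_
  rw [inner_sum]
  refine Finset.sum_congr rfl fun j _ => ?_
  rw [real_inner_smul_left, real_inner_smul_right]
  ring

/-- The space of continuous bilinear forms on a normed space. The abbreviation fixes the topology of
`E` to be the one of the norm, also for `E = EuclideanSpace ℝ (Fin n)`. -/
abbrev BilinForm (E : Type*) [NormedAddCommGroup E] [NormedSpace ℝ E] := E →L[ℝ] E →L[ℝ] ℝ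

/-- The bilinear form `∑ aᵢⱼ ℓᵢ ⊗ ℓⱼ`. -/
noncomputable def tensorForm {ι E : Type*} [Fintype ι] [NormedAddCommGroup E] [NormedSpace ℝ E]
    (ℓ : ι → StrongDual ℝ E) (a : Matrix ι ι ℝ) : BilinForm E :=
  ∑ i, ∑ j, a i j • (ℓ i).smulRight (ℓ j)

/-- `ContDiffOn.smul_const` for a real function and a vector. Stated for an abstract space `F`, since
the instance it needs is not found when `F` is a space of bilinear forms. -/
theorem contDiffOn_smul_const_right {E F : Type*} [NormedAddCommGroup E] [NormedSpace ℝ E]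
    [NormedAddCommGroup F] [NormedSpace ℝ F] {s : Set E} {k : ℕ∞ω} {f : E → ℝ}
    (hf : ContDiffOn ℝ k f s) (c : F) : ContDiffOn ℝ k (fun x => f x • c) s :=
  hf.smul_const c

theorem contDiffOn_tensorForm {ι E : Type*} [Fintype ι] [NormedAddCommGroup E] [NormedSpace ℝ E]
    (ℓ : ι → StrongDual ℝ E) {a : E → Matrix ι ι ℝ} {s : Set E} {k : ℕ∞ω}
    (ha : ∀ i j, ContDiffOn ℝ k (fun y => a y i j) s) :
    ContDiffOn ℝ k (fun y => tensorForm ℓ (a y)) s := by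
  unfold tensorForm
  exact ContDiffOn.sum fun i _ => ContDiffOn.sum fun j _ => contDiffOn_smul_const_right (ha i j) _

/-- The bilinear form `∑ aᵢⱼ dyᵢ ⊗ dyⱼ`. -/
noncomputable def matrixForm {n : ℕ} (a : Matrix (Fin n) (Fin n) ℝ) :
    BilinForm (EuclideanSpace ℝ (Fin n)) :=
  tensorForm (fun i => EuclideanSpace.proj (𝕜 := ℝ) i) a

theorem matrixForm_apply {n : ℕ} (a : Matrix (Fin n) (Fin n) ℝ) (u v : EuclideanSpace ℝ (Fin n)) :
    matrixForm a u v = ∑ i, ∑ j, a i j * (u i * v j) := by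
  simp [matrixForm, tensorForm]

variable {n : ℕ} {M : Type*} [TopologicalSpace M] [ChartedSpace (EuclideanSpace ℝ (Fin n)) M]

/-- The coordinate vector fields are smooth sections of the tangent bundle along the inverse of the
chart. -/
theorem contMDiffOn_coordVec [IsManifold (𝓡 n) ∞ M]
    {φ : OpenPartialHomeomorph M (EuclideanSpace ℝ (Fin n))}
    (hφ : φ ∈ atlas (EuclideanSpace ℝ (Fin n)) M) (i : Fin n) :
    ContMDiffOn (𝓡 n) (𝓡 n).tangent 2
      (fun y => (⟨φ.symm y, coordVec φ y i⟩ : TangentBundle (𝓡 n) M)) φ.target := by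
  have h1 : ContMDiffOn (𝓡 n) (𝓡 n) 3 φ.symm φ.target :=
    (contMDiffOn_symm_of_mem_maximalAtlas (IsManifold.subset_maximalAtlas (n := ∞) hφ)).of_le
      ENat.LEInfty.out
  have h2 := h1.contMDiffOn_tangentMapWithin (m := 2) (by norm_num) φ.open_target.uniqueMDiffOn
  have h3 : ContMDiff (𝓡 n) (𝓡 n).tangent 2 (fun y : EuclideanSpace ℝ (Fin n) =>
      (⟨y, EuclideanSpace.single i (1 : ℝ)⟩ : TangentBundle (𝓡 n) (EuclideanSpace ℝ (Fin n)))) := by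
    exact (contMDiff_vectorSpace_iff_contDiff
      (V := fun y : EuclideanSpace ℝ (Fin n) => EuclideanSpace.single i (1 : ℝ))).2 contDiff_const
  refine (h2.comp h3.contMDiffOn (fun y hy => hy)).congr fun y hy => ?_
  simp only [Function.comp, tangentMapWithin, coordVec]
  rw [mfderivWithin_of_isOpen φ.open_target hy]

variable [RiemannianBundle (fun x : M => TangentSpace (𝓡 n) x)]

theorem matrixForm_metricMatrix (φ : OpenPartialHomeomorph M (EuclideanSpace ℝ (Fin n)))
    (y u v : EuclideanSpace ℝ (Fin n)) :
    matrixForm (metricMatrix φ y) u v =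
      inner ℝ (mfderiv (𝓡 n) (𝓡 n) φ.symm y u : TangentSpace (𝓡 n) (φ.symm y))
        (mfderiv (𝓡 n) (𝓡 n) φ.symm y v) := by
  rw [matrixForm_apply]
  exact (inner_map_eq_sum (mfderiv (𝓡 n) (𝓡 n) φ.symm y).toLinearMap u v).symm

variable [IsManifold (𝓡 n) ∞ M] [IsContMDiffRiemannianBundle (𝓡 n) 2 (EuclideanSpace ℝ (Fin n))
      (fun x : M => TangentSpace (𝓡 n) x)]

theorem contDiffOn_metricMatrix {φ : OpenPartialHomeomorph M (EuclideanSpace ℝ (Fin n))}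
    (hφ : φ ∈ atlas (EuclideanSpace ℝ (Fin n)) M) (i j : Fin n) :
    ContDiffOn ℝ 2 (fun y => metricMatrix φ y i j) φ.target := by
  rw [← contMDiffOn_iff_contDiffOn]
  exact ContMDiffOn.inner_bundle (contMDiffOn_coordVec hφ i) (contMDiffOn_coordVec hφ j)

theorem contDiffOn_matrixForm_metricMatrix
    {φ : OpenPartialHomeomorph M (EuclideanSpace ℝ (Fin n))}
    (hφ : φ ∈ atlas (EuclideanSpace ℝ (Fin n)) M) :
    ContDiffOn ℝ 2 (fun y => matrixForm (metricMatrix φ y)) φ.target :=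
  contDiffOn_tensorForm _ fun i j => contDiffOn_metricMatrix hφ i j

end MetricForm

section Transition

variable {n : ℕ} {M : Type*} [TopologicalSpace M]

theorem isOpen_transition_domain (φ ψ : OpenPartialHomeomorph M (EuclideanSpace ℝ (Fin n))) :
    IsOpen (φ.target ∩ φ.symm ⁻¹' ψ.source) :=
  φ.symm.isOpen_inter_preimage ψ.open_source

variable [ChartedSpace (EuclideanSpace ℝ (Fin n)) M]
  [IsManifold (𝓡 n) ∞ M] {φ ψ : OpenPartialHomeomorph M (EuclideanSpace ℝ (Fin n))}

theorem contDiffOn_transition (hφ : φ ∈ atlas (EuclideanSpace ℝ (Fin n)) M)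
    (hψ : ψ ∈ atlas (EuclideanSpace ℝ (Fin n)) M) :
    ContDiffOn ℝ ∞ (ψ ∘ φ.symm) (φ.target ∩ φ.symm ⁻¹' ψ.source) := by
  rw [← contMDiffOn_iff_contDiffOn]
  exact (contMDiffOn_of_mem_maximalAtlas (IsManifold.subset_maximalAtlas hψ)).comp
    ((contMDiffOn_symm_of_mem_maximalAtlas (IsManifold.subset_maximalAtlas hφ)).mono
      inter_subset_left) (fun y hy => hy.2)

theorem contDiffAt_transition (hφ : φ ∈ atlas (EuclideanSpace ℝ (Fin n)) M)
    (hψ : ψ ∈ atlas (EuclideanSpace ℝ (Fin n)) M) {y : EuclideanSpace ℝ (Fin n)}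
    (hy : y ∈ φ.target ∩ φ.symm ⁻¹' ψ.source) : ContDiffAt ℝ ∞ (ψ ∘ φ.symm) y :=
  (contDiffOn_transition hφ hψ).contDiffAt ((isOpen_transition_domain φ ψ).mem_nhds hy)

theorem mfderiv_symm_eq (hφ : φ ∈ atlas (EuclideanSpace ℝ (Fin n)) M)
    (hψ : ψ ∈ atlas (EuclideanSpace ℝ (Fin n)) M) {y : EuclideanSpace ℝ (Fin n)}
    (hy : y ∈ φ.target ∩ φ.symm ⁻¹' ψ.source) (u : EuclideanSpace ℝ (Fin n)) :
    (mfderiv (𝓡 n) (𝓡 n) φ.symm y u : EuclideanSpace ℝ (Fin n)) =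
      mfderiv (𝓡 n) (𝓡 n) ψ.symm ((ψ ∘ φ.symm) y) (fderiv ℝ (ψ ∘ φ.symm) y u) := by
  have h1 : MDifferentiableAt (𝓡 n) (𝓡 n) ψ.symm ((ψ ∘ φ.symm) y) :=
    mdifferentiableAt_atlas_symm hψ (ψ.map_source hy.2)
  have h2 : MDifferentiableAt (𝓡 n) (𝓡 n) (ψ ∘ φ.symm) y :=
    ((contDiffAt_transition hφ hψ hy).differentiableAt (by simp)).mdifferentiableAt
  have h3 : (φ.symm : _ → M) =ᶠ[nhds y] ψ.symm ∘ (ψ ∘ φ.symm) := by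
    filter_upwards [(isOpen_transition_domain φ ψ).mem_nhds hy] with z hz
    exact (ψ.left_inv hz.2).symm
  rw [h3.mfderiv_eq, mfderiv_comp y h1 h2, ← mfderiv_eq_fderiv]
  rfl

theorem mfderiv_chart_eq (hφ : φ ∈ atlas (EuclideanSpace ℝ (Fin n)) M)
    (hψ : ψ ∈ atlas (EuclideanSpace ℝ (Fin n)) M) {x : M} (hx : x ∈ φ.source) (hx' : x ∈ ψ.source)
    (v : TangentSpace (𝓡 n) x) :
    (mfderiv (𝓡 n) (𝓡 n) ψ x v : EuclideanSpace ℝ (Fin n)) =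
      fderiv ℝ (ψ ∘ φ.symm) (φ x) (mfderiv (𝓡 n) (𝓡 n) φ x v : EuclideanSpace ℝ (Fin n)) := by
  have hy : φ x ∈ φ.target ∩ φ.symm ⁻¹' ψ.source :=
    ⟨φ.map_source hx, by simpa [φ.left_inv hx] using hx'⟩
  have h1 : MDifferentiableAt (𝓡 n) (𝓡 n) φ x := mdifferentiableAt_atlas hφ hx
  have h2 : MDifferentiableAt (𝓡 n) (𝓡 n) (ψ ∘ φ.symm) (φ x) :=
    ((contDiffAt_transition hφ hψ hy).differentiableAt (by simp)).mdifferentiableAt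
  have h3 : (ψ : M → _) =ᶠ[nhds x] (ψ ∘ φ.symm) ∘ φ := by
    filter_upwards [φ.open_source.mem_nhds hx] with z hz
    simp [φ.left_inv hz]
  rw [h3.mfderiv_eq, mfderiv_comp x h2 h1, ← mfderiv_eq_fderiv]
  rfl

theorem transition_comp_transition_symm (hφ : φ ∈ atlas (EuclideanSpace ℝ (Fin n)) M)
    (hψ : ψ ∈ atlas (EuclideanSpace ℝ (Fin n)) M) {y : EuclideanSpace ℝ (Fin n)}
    (hy : y ∈ φ.target ∩ φ.symm ⁻¹' ψ.source) (w : EuclideanSpace ℝ (Fin n)) :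
    fderiv ℝ (ψ ∘ φ.symm) y (fderiv ℝ (φ ∘ ψ.symm) ((ψ ∘ φ.symm) y) w) = w := by
  have hy' : (ψ ∘ φ.symm) y ∈ ψ.target ∩ ψ.symm ⁻¹' φ.source :=
    ⟨ψ.map_source hy.2, by simpa [ψ.left_inv hy.2] using φ.map_target hy.1⟩
  have e : (φ ∘ ψ.symm) ((ψ ∘ φ.symm) y) = y := by simp [ψ.left_inv hy.2, φ.right_inv hy.1]
  have h1 : (ψ ∘ φ.symm) ∘ (φ ∘ ψ.symm) =ᶠ[nhds ((ψ ∘ φ.symm) y)] id := by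
    filter_upwards [(isOpen_transition_domain ψ φ).mem_nhds hy'] with z hz
    simp [φ.left_inv hz.2, ψ.right_inv hz.1]
  have h2 := fderiv_comp (𝕜 := ℝ) (g := ψ ∘ φ.symm) (f := φ ∘ ψ.symm) ((ψ ∘ φ.symm) y)
    (by rw [e]; exact (contDiffAt_transition hφ hψ hy).differentiableAt (by simp))
    ((contDiffAt_transition hψ hφ hy').differentiableAt (by simp))
  rw [h1.fderiv_eq, fderiv_id, e] at h2
  exact (congrArg (fun L => L w) h2).symm

theorem bijective_fderiv_transition (hφ : φ ∈ atlas (EuclideanSpace ℝ (Fin n)) M)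
    (hψ : ψ ∈ atlas (EuclideanSpace ℝ (Fin n)) M) {y : EuclideanSpace ℝ (Fin n)}
    (hy : y ∈ φ.target ∩ φ.symm ⁻¹' ψ.source) :
    Function.Bijective (fderiv ℝ (ψ ∘ φ.symm) y) := by
  have h : Function.Surjective (fderiv ℝ (ψ ∘ φ.symm) y).toLinearMap :=
    fun w => ⟨_, transition_comp_transition_symm hφ hψ hy w⟩
  exact ⟨LinearMap.injective_iff_surjective.2 h, h⟩

theorem contDiffAt_comp_symm (hφ : φ ∈ atlas (EuclideanSpace ℝ (Fin n)) M)
    {y : EuclideanSpace ℝ (Fin n)} (hy : y ∈ φ.target) {f : M → ℝ}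
    (hf : ContMDiffAt (𝓡 n) 𝓘(ℝ) ∞ f (φ.symm y)) : ContDiffAt ℝ ∞ (f ∘ φ.symm) y := by
  rw [← contMDiffAt_iff_contDiffAt]
  exact hf.comp y ((contMDiffOn_symm_of_mem_maximalAtlas
    (IsManifold.subset_maximalAtlas hφ)).contMDiffAt (φ.open_target.mem_nhds hy))

end Transition

section MetricTransition

variable {n : ℕ} {M : Type*} [TopologicalSpace M] [ChartedSpace (EuclideanSpace ℝ (Fin n)) M]

/-- The coordinates `(v¹, …, vⁿ)` of a tangent vector in the chart `φ`. -/
noncomputable def coords (φ : OpenPartialHomeomorph M (EuclideanSpace ℝ (Fin n))) {x : M}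
    (v : TangentSpace (𝓡 n) x) : EuclideanSpace ℝ (Fin n) :=
  mfderiv (𝓡 n) (𝓡 n) φ x v

variable [RiemannianBundle (fun x : M => TangentSpace (𝓡 n) x)]

/-- The Riemannian inner product at `x`, on vectors of the model space. Since the tangent spaces
are copies of the model space, this allows comparing inner products at equal points. -/
noncomputable def innerAt (x : M) (v w : EuclideanSpace ℝ (Fin n)) : ℝ :=
  inner ℝ (show TangentSpace (𝓡 n) x from v) (show TangentSpace (𝓡 n) x from w)

variable {φ ψ : OpenPartialHomeomorph M (EuclideanSpace ℝ (Fin n))}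

theorem matrixForm_metricMatrix_comm (y u v : EuclideanSpace ℝ (Fin n)) :
    matrixForm (metricMatrix φ y) u v = matrixForm (metricMatrix φ y) v u := by
  rw [matrixForm_metricMatrix, matrixForm_metricMatrix, real_inner_comm]

variable [IsManifold (𝓡 n) ∞ M]

/-- The metrics of two charts are related by pullback along the transition map. -/
theorem matrixForm_metricMatrix_transition (hφ : φ ∈ atlas (EuclideanSpace ℝ (Fin n)) M)
    (hψ : ψ ∈ atlas (EuclideanSpace ℝ (Fin n)) M) {y : EuclideanSpace ℝ (Fin n)}
    (hy : y ∈ φ.target ∩ φ.symm ⁻¹' ψ.source) (u v : EuclideanSpace ℝ (Fin n)) :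
    matrixForm (metricMatrix φ y) u v = matrixForm (metricMatrix ψ ((ψ ∘ φ.symm) y))
      (fderiv ℝ (ψ ∘ φ.symm) y u) (fderiv ℝ (ψ ∘ φ.symm) y v) := by
  have e : ψ.symm ((ψ ∘ φ.symm) y) = φ.symm y := ψ.left_inv hy.2
  refine (matrixForm_metricMatrix φ y u v).trans
    (Eq.trans ?_ (matrixForm_metricMatrix ψ _ _ _).symm)
  refine Eq.trans ?_ (congrArg (fun x => innerAt x
    (mfderiv (𝓡 n) (𝓡 n) ψ.symm ((ψ ∘ φ.symm) y) (fderiv ℝ (ψ ∘ φ.symm) y u))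
    (mfderiv (𝓡 n) (𝓡 n) ψ.symm ((ψ ∘ φ.symm) y) (fderiv ℝ (ψ ∘ φ.symm) y v))) e.symm)
  exact congrArg₂ (innerAt (φ.symm y)) (mfderiv_symm_eq hφ hψ hy u) (mfderiv_symm_eq hφ hψ hy v)

/-- The Riemannian inner product computed in coordinates. -/
theorem matrixForm_metricMatrix_coords (hφ : φ ∈ atlas (EuclideanSpace ℝ (Fin n)) M) {x : M}
    (hx : x ∈ φ.source) (v w : TangentSpace (𝓡 n) x) :
    matrixForm (metricMatrix φ (φ x)) (coords φ v) (coords φ w) = inner ℝ v w := by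
  have h := (mdifferentiable_of_mem_atlas (I := 𝓡 n) hφ).symm_comp_deriv hx
  refine (matrixForm_metricMatrix φ _ _ _).trans ?_
  refine (congrArg (fun z => innerAt z
    (mfderiv (𝓡 n) (𝓡 n) φ.symm (φ x) (coords φ v))
    (mfderiv (𝓡 n) (𝓡 n) φ.symm (φ x) (coords φ w))) (φ.left_inv hx)).trans ?_
  exact congrArg₂ (innerAt x)
    (DFunLike.congr_fun h v) (DFunLike.congr_fun h w)

theorem matrixForm_metricMatrix_self_pos (hφ : φ ∈ atlas (EuclideanSpace ℝ (Fin n)) M)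
    {y : EuclideanSpace ℝ (Fin n)} (hy : y ∈ φ.target) {u : EuclideanSpace ℝ (Fin n)}
    (hu : u ≠ 0) : 0 < matrixForm (metricMatrix φ y) u u := by
  rw [matrixForm_metricMatrix]
  have hinj := (mdifferentiable_of_mem_atlas (I := 𝓡 n) hφ).symm.mfderiv_injective
    (x := y) hy
  refine real_inner_self_pos.2 fun h0 => hu (hinj ?_)
  rw [h0]
  exact (map_zero (mfderiv (𝓡 n) (𝓡 n) φ.symm y)).symm

theorem posDef_metricMatrix (hφ : φ ∈ atlas (EuclideanSpace ℝ (Fin n)) M)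
    {y : EuclideanSpace ℝ (Fin n)} (hy : y ∈ φ.target) : (metricMatrix φ y).PosDef := by
  refine Matrix.PosDef.of_dotProduct_mulVec_pos ?_ fun v hv => ?_
  · ext i j
    simp [metricMatrix, real_inner_comm]
  · have h := matrixForm_metricMatrix_self_pos hφ hy (u := WithLp.toLp 2 v)
      (fun h => hv (by simpa using congrArg WithLp.ofLp h))
    rw [matrixForm_apply] at h
    simp only [star_trivial, dotProduct, Matrix.mulVec, Finset.mul_sum]
    refine h.trans_eq (Finset.sum_congr rfl fun i _ => Finset.sum_congr rfl fun j _ => ?_)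
    simp only []
    ring

end MetricTransition

/-! ### The Hessian in an arbitrary chart -/

section HessianChart

open Filter Topology

theorem matrixForm_eq_dotProduct {n : ℕ} (a : Matrix (Fin n) (Fin n) ℝ)
    (u v : EuclideanSpace ℝ (Fin n)) :
    matrixForm a u v = u.ofLp ⬝ᵥ (Matrix.mulVec a v.ofLp) := by
  rw [matrixForm_apply]
  simp only [dotProduct, Matrix.mulVec, Finset.mul_sum]
  exact Finset.sum_congr rfl fun i _ => Finset.sum_congr rfl fun j _ => by ring

theorem clm_apply_eq_sum {n : ℕ} {F : Type*} [AddCommGroup F] [Module ℝ F] [TopologicalSpace F]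
    (L : EuclideanSpace ℝ (Fin n) →L[ℝ] F)
    (u : EuclideanSpace ℝ (Fin n)) : L u = ∑ i, u i • L (EuclideanSpace.single i 1) := by
  conv_lhs => rw [← (EuclideanSpace.basisFun (Fin n) ℝ).sum_repr u, map_sum]
  simp

theorem fderiv_matrixForm_apply {n : ℕ} {a : EuclideanSpace ℝ (Fin n) → Matrix (Fin n) (Fin n) ℝ}
    {y : EuclideanSpace ℝ (Fin n)} (ha : DifferentiableAt ℝ (fun z => matrixForm (a z)) y)
    (ha' : ∀ i j, DifferentiableAt ℝ (fun z => a z i j) y) (u v w : EuclideanSpace ℝ (Fin n)) :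
    fderiv ℝ (fun z => matrixForm (a z)) y u v w =
      ∑ i, ∑ j, ∑ k, pderiv i (fun z => a z j k) y * (u i * v j * w k) := by
  have h1 := (ha.hasFDerivAt.clm_apply (hasFDerivAt_const v y)).clm_apply (hasFDerivAt_const w y)
  have h2 : HasFDerivAt (fun z => matrixForm (a z) v w)
      (∑ j, ∑ k, (v j * w k) • fderiv ℝ (fun z => a z j k) y) y := by
    simp only [matrixForm_apply]
    exact HasFDerivAt.fun_sum fun j _ => HasFDerivAt.fun_sum fun k _ =>
      (ha' j k).hasFDerivAt.mul_const _
  have h3 := congrArg (fun L => L u) (h1.unique h2)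
  have h4 : fderiv ℝ (fun z => matrixForm (a z)) y u v w =
      ∑ j, ∑ k, (v j * w k) * fderiv ℝ (fun z => a z j k) y u := by
    simpa using h3
  rw [h4]
  simp only [clm_apply_eq_sum (fderiv ℝ (fun z => a z _ _) y) u, smul_eq_mul, Finset.mul_sum]
  rw [Finset.sum_congr rfl fun j _ => Finset.sum_comm, Finset.sum_comm]
  refine Finset.sum_congr rfl fun i _ => Finset.sum_congr rfl fun j _ =>
    Finset.sum_congr rfl fun k _ => ?_
  rw [pderiv]
  ring

variable {n : ℕ} {M : Type*} [TopologicalSpace M] [ChartedSpace (EuclideanSpace ℝ (Fin n)) M]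
  [RiemannianBundle (fun x : M => TangentSpace (𝓡 n) x)]

/-- The vector `Γ(u, v)` with components `∑ Γᵏᵢⱼ uⁱ vʲ`. -/
noncomputable def christoffelVec (φ : OpenPartialHomeomorph M (EuclideanSpace ℝ (Fin n)))
    (y u v : EuclideanSpace ℝ (Fin n)) : EuclideanSpace ℝ (Fin n) :=
  WithLp.toLp 2 fun k => ∑ i, ∑ j, christoffel φ y k i j * (u i * v j)

/-- The Hessian as a bilinear form on the coordinate space. -/
noncomputable def hessForm (f : M → ℝ) (φ : OpenPartialHomeomorph M (EuclideanSpace ℝ (Fin n)))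
    (y : EuclideanSpace ℝ (Fin n)) : BilinForm (EuclideanSpace ℝ (Fin n)) :=
  matrixForm (Matrix.of (hessMatrix f φ y))

/-- The coordinate-free form `D²F(u,v) - DF(Γ(u,v))` of the Hessian in a chart. -/
theorem hessForm_eq_fderiv {f : M → ℝ} {φ : OpenPartialHomeomorph M (EuclideanSpace ℝ (Fin n))}
    {y : EuclideanSpace ℝ (Fin n)} (hf : ContDiffAt ℝ 2 (f ∘ φ.symm) y)
    (u v : EuclideanSpace ℝ (Fin n)) :
    hessForm f φ y u v = fderiv ℝ (fderiv ℝ (f ∘ φ.symm)) y u v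
      - fderiv ℝ (f ∘ φ.symm) y (christoffelVec φ y u v) := by
  have hD : DifferentiableAt ℝ (fderiv ℝ (f ∘ φ.symm)) y :=
    (hf.fderiv_right (m := 1) (by norm_num)).differentiableAt one_ne_zero
  have h1 : ∀ i j, secondPartial f φ y i j = fderiv ℝ (fderiv ℝ (f ∘ φ.symm)) y
      (EuclideanSpace.single i 1) (EuclideanSpace.single j 1) := by
    intro i j
    have := (hD.hasFDerivAt.clm_apply
      (hasFDerivAt_const (EuclideanSpace.single j (1 : ℝ)) y)).fderiv
    have h := congrArg (fun L => L (EuclideanSpace.single i (1 : ℝ))) this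
    exact h.trans (by simp)
  have h2 : fderiv ℝ (fderiv ℝ (f ∘ φ.symm)) y u v =
      ∑ i, ∑ j, secondPartial f φ y i j * (u i * v j) := by
    rw [clm_apply_eq_sum (fderiv ℝ (fderiv ℝ (f ∘ φ.symm)) y) u, sum_apply]
    refine Finset.sum_congr rfl fun i _ => ?_
    rw [smul_apply, clm_apply_eq_sum _ v, smul_eq_mul, Finset.mul_sum]
    refine Finset.sum_congr rfl fun j _ => ?_
    rw [h1, smul_eq_mul]
    ring
  have h3 : fderiv ℝ (f ∘ φ.symm) y (christoffelVec φ y u v) =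
      ∑ i, ∑ j, (∑ k, christoffel φ y k i j * pderiv k (f ∘ φ.symm) y) * (u i * v j) := by
    rw [clm_apply_eq_sum (fderiv ℝ (f ∘ φ.symm) y)]
    simp only [christoffelVec, smul_eq_mul, Finset.sum_mul]
    rw [Finset.sum_comm]
    refine Finset.sum_congr rfl fun i _ => ?_
    rw [Finset.sum_comm]
    refine Finset.sum_congr rfl fun j _ => Finset.sum_congr rfl fun k _ => ?_
    rw [pderiv]
    ring
  rw [hessForm, matrixForm_apply, h2, h3, ← Finset.sum_sub_distrib]
  refine Finset.sum_congr rfl fun i _ => ?_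
  rw [← Finset.sum_sub_distrib]
  refine Finset.sum_congr rfl fun j _ => ?_
  rw [Matrix.of_apply, hessMatrix]
  ring

variable [IsManifold (𝓡 n) ∞ M] [IsContMDiffRiemannianBundle (𝓡 n) 2 (EuclideanSpace ℝ (Fin n))
      (fun x : M => TangentSpace (𝓡 n) x)]
  {φ ψ : OpenPartialHomeomorph M (EuclideanSpace ℝ (Fin n))}

theorem differentiableAt_metricMatrix (hφ : φ ∈ atlas (EuclideanSpace ℝ (Fin n)) M)
    {y : EuclideanSpace ℝ (Fin n)} (hy : y ∈ φ.target) (i j : Fin n) :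
    DifferentiableAt ℝ (fun z => metricMatrix φ z i j) y :=
  ((contDiffOn_metricMatrix hφ i j).contDiffAt (φ.open_target.mem_nhds hy)).differentiableAt
    (by norm_num)

theorem differentiableAt_matrixForm_metricMatrix (hφ : φ ∈ atlas (EuclideanSpace ℝ (Fin n)) M)
    {y : EuclideanSpace ℝ (Fin n)} (hy : y ∈ φ.target) :
    DifferentiableAt ℝ (fun z => matrixForm (metricMatrix φ z)) y :=
  ((contDiffOn_matrixForm_metricMatrix hφ).contDiffAt
    (φ.open_target.mem_nhds hy)).differentiableAt (by norm_num)

/-- `Γ(u, v)` is the metric dual of half the Koszul expression. -/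
theorem matrixForm_christoffelVec (hφ : φ ∈ atlas (EuclideanSpace ℝ (Fin n)) M)
    {y : EuclideanSpace ℝ (Fin n)} (hy : y ∈ φ.target) (u v w : EuclideanSpace ℝ (Fin n)) :
    matrixForm (metricMatrix φ y) (christoffelVec φ y u v) w =
      koszul (fun z => matrixForm (metricMatrix φ z)) y u v w / 2 := by
  set c : Fin n → Fin n → Fin n → ℝ := fun l i j =>
    pderiv i (fun z => metricMatrix φ z j l) y + pderiv j (fun z => metricMatrix φ z i l) y
      - pderiv l (fun z => metricMatrix φ z i j) y with hc
  set κ : Fin n → ℝ := fun l => ∑ i, ∑ j, c l i j * (u i * v j) with hκ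
  have hdet : IsUnit (metricMatrix φ y).det := (posDef_metricMatrix hφ hy).det_pos.ne'.isUnit
  have hΓ : (christoffelVec φ y u v).ofLp =
      (1 / 2 : ℝ) • Matrix.mulVec (metricMatrix φ y)⁻¹ κ := by
    ext k
    simp only [christoffelVec, christoffel, Pi.smul_apply, smul_eq_mul, Matrix.mulVec, dotProduct,
      hκ, Finset.mul_sum, Finset.sum_mul]
    rw [Finset.sum_congr rfl fun i _ => Finset.sum_comm, Finset.sum_comm]
    refine Finset.sum_congr rfl fun l _ => Finset.sum_congr rfl fun i _ =>
      Finset.sum_congr rfl fun j _ => ?_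
    rw [hc]
    ring
  have hg : Matrix.mulVec (metricMatrix φ y) (christoffelVec φ y u v).ofLp = (1 / 2 : ℝ) • κ := by
    rw [hΓ, Matrix.mulVec_smul, Matrix.mulVec_mulVec, Matrix.mul_nonsing_inv _ hdet,
      Matrix.one_mulVec]
  have hd := fun u v w => fderiv_matrixForm_apply
    (differentiableAt_matrixForm_metricMatrix hφ hy) (differentiableAt_metricMatrix hφ hy) u v w
  rw [matrixForm_metricMatrix_comm, matrixForm_eq_dotProduct, hg, koszul, hd, hd, hd]
  have e2 : ∑ i, ∑ j, ∑ k, pderiv i (fun z => metricMatrix φ z j k) y * (v i * u j * w k) =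
      ∑ i, ∑ j, ∑ k, pderiv j (fun z => metricMatrix φ z i k) y * (u i * v j * w k) := by
    rw [Finset.sum_comm]
    refine Finset.sum_congr rfl fun i _ => Finset.sum_congr rfl fun j _ =>
      Finset.sum_congr rfl fun k _ => by ring
  have e3 : ∑ i, ∑ j, ∑ k, pderiv i (fun z => metricMatrix φ z j k) y * (w i * u j * v k) =
      ∑ i, ∑ j, ∑ k, pderiv k (fun z => metricMatrix φ z i j) y * (u i * v j * w k) := by
    rw [Finset.sum_comm, Finset.sum_congr rfl fun i _ => Finset.sum_comm]
    refine Finset.sum_congr rfl fun i _ => Finset.sum_congr rfl fun j _ =>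
      Finset.sum_congr rfl fun k _ => by ring
  rw [e2, e3]
  simp only [dotProduct, Pi.smul_apply, smul_eq_mul, hκ, hc, Finset.mul_sum]
  rw [Finset.sum_comm, Finset.sum_congr rfl fun i _ => Finset.sum_comm,
    ← Finset.sum_add_distrib, ← Finset.sum_sub_distrib, Finset.sum_div]
  refine Finset.sum_congr rfl fun i _ => ?_
  rw [← Finset.sum_add_distrib, ← Finset.sum_sub_distrib, Finset.sum_div]
  refine Finset.sum_congr rfl fun j _ => ?_
  rw [← Finset.sum_add_distrib, ← Finset.sum_sub_distrib, Finset.sum_div]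
  refine Finset.sum_congr rfl fun k _ => ?_
  ring

/-- The Hessian does not depend on the chart. -/
theorem hessForm_transition (hφ : φ ∈ atlas (EuclideanSpace ℝ (Fin n)) M)
    (hψ : ψ ∈ atlas (EuclideanSpace ℝ (Fin n)) M) {y : EuclideanSpace ℝ (Fin n)}
    (hy : y ∈ φ.target ∩ φ.symm ⁻¹' ψ.source) {f : M → ℝ}
    (hf : ContMDiffAt (𝓡 n) 𝓘(ℝ) ∞ f (φ.symm y)) (u v : EuclideanSpace ℝ (Fin n)) :
    hessForm f φ y u v = hessForm f ψ ((ψ ∘ φ.symm) y)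
      (fderiv ℝ (ψ ∘ φ.symm) y u) (fderiv ℝ (ψ ∘ φ.symm) y v) := by
  have hy' : (ψ ∘ φ.symm) y ∈ ψ.target := ψ.map_source hy.2
  have hF : ContDiffAt ℝ 2 (f ∘ φ.symm) y :=
    (contDiffAt_comp_symm hφ hy.1 hf).of_le ENat.LEInfty.out
  have e : ψ.symm ((ψ ∘ φ.symm) y) = φ.symm y := ψ.left_inv hy.2
  have hF' : ContDiffAt ℝ 2 (f ∘ ψ.symm) ((ψ ∘ φ.symm) y) :=
    (contDiffAt_comp_symm hψ hy' (by rwa [e])).of_le ENat.LEInfty.out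
  have hτ : ContDiffAt ℝ 2 (ψ ∘ φ.symm) y :=
    (contDiffAt_transition hφ hψ hy).of_le ENat.LEInfty.out
  rw [hessForm_eq_fderiv hF, hessForm_eq_fderiv hF']
  refine hessian_pullback hF' hτ ?_ ?_ u v
  · filter_upwards [(isOpen_transition_domain φ ψ).mem_nhds hy] with z hz
    simp [ψ.left_inv hz.2]
  · refine christoffel_pullback (b := fun z => matrixForm (metricMatrix φ z))
      (b' := fun z => matrixForm (metricMatrix ψ z))
      (differentiableAt_matrixForm_metricMatrix hφ hy.1)
      (differentiableAt_matrixForm_metricMatrix hψ hy') hτ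
      (matrixForm_metricMatrix_comm _) ?_ (bijective_fderiv_transition hφ hψ hy).2 ?_
      (matrixForm_christoffelVec hφ hy.1) (matrixForm_christoffelVec hψ hy')
    · intro u hu
      by_contra h0
      exact (matrixForm_metricMatrix_self_pos hψ hy' h0).ne' (hu u)
    · filter_upwards [(isOpen_transition_domain φ ψ).mem_nhds hy] with z hz
      ext u v
      exact matrixForm_metricMatrix_transition hφ hψ hz u v

end HessianChart

/-! ### Chart independence and continuity of the Hessian and the Laplacian -/

section MatrixAlgebra

variable {n : ℕ}

/-- The matrix of an endomorphism of the coordinate space in the standard basis. -/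
noncomputable def stdMatrix (L : EuclideanSpace ℝ (Fin n) →L[ℝ] EuclideanSpace ℝ (Fin n)) :
    Matrix (Fin n) (Fin n) ℝ :=
  LinearMap.toMatrix (EuclideanSpace.basisFun (Fin n) ℝ).toBasis
    (EuclideanSpace.basisFun (Fin n) ℝ).toBasis L.toLinearMap

theorem stdMatrix_apply (L : EuclideanSpace ℝ (Fin n) →L[ℝ] EuclideanSpace ℝ (Fin n))
    (i j : Fin n) : stdMatrix L i j = L (EuclideanSpace.single j 1) i := by
  simp [stdMatrix, LinearMap.toMatrix_apply]

theorem det_stdMatrix (L : EuclideanSpace ℝ (Fin n) →L[ℝ] EuclideanSpace ℝ (Fin n)) :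
    (stdMatrix L).det = L.det :=
  LinearMap.det_toMatrix _ _

theorem matrixForm_single (a : Matrix (Fin n) (Fin n) ℝ) (i j : Fin n) :
    matrixForm a (EuclideanSpace.single i 1) (EuclideanSpace.single j 1) = a i j := by
  simp [matrixForm_eq_dotProduct]

theorem eq_transpose_mul_mul_of_matrixForm {a a' : Matrix (Fin n) (Fin n) ℝ}
    {L : EuclideanSpace ℝ (Fin n) →L[ℝ] EuclideanSpace ℝ (Fin n)}
    (h : ∀ u v, matrixForm a u v = matrixForm a' (L u) (L v)) :
    a = (stdMatrix L).transpose * a' * stdMatrix L := by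
  ext i j
  rw [← matrixForm_single a, h, matrixForm_apply, Matrix.mul_apply]
  simp only [Matrix.mul_apply, Matrix.transpose_apply, stdMatrix_apply, Finset.sum_mul]
  rw [Finset.sum_comm]
  exact Finset.sum_congr rfl fun k _ => Finset.sum_congr rfl fun l _ => by ring

/-- The trace `∑ gⁱʲ hᵢⱼ` of a bilinear form with respect to a metric. -/
noncomputable def metricTrace (g h : Matrix (Fin n) (Fin n) ℝ) : ℝ :=
  ∑ i, ∑ j, g⁻¹ i j * h i j

theorem metricTrace_eq_trace (g h : Matrix (Fin n) (Fin n) ℝ) :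
    metricTrace g h = (g⁻¹ * h.transpose).trace := by
  simp [metricTrace, Matrix.trace, Matrix.mul_apply]

theorem metricTrace_congruence {g h D : Matrix (Fin n) (Fin n) ℝ} (hD : IsUnit D.det) :
    metricTrace (D.transpose * g * D) (D.transpose * h * D) = metricTrace g h := by
  have hD' : IsUnit D.transpose.det := by rwa [Matrix.det_transpose]
  rw [metricTrace_eq_trace, metricTrace_eq_trace, Matrix.mul_inv_rev, Matrix.mul_inv_rev]
  simp only [Matrix.transpose_mul, Matrix.transpose_transpose]
  rw [show D⁻¹ * (g⁻¹ * D.transpose⁻¹) * (D.transpose * (h.transpose * D)) =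
      D⁻¹ * (g⁻¹ * (D.transpose⁻¹ * D.transpose) * h.transpose * D) by simp only [Matrix.mul_assoc],
    Matrix.nonsing_inv_mul _ hD', Matrix.mul_one, Matrix.trace_mul_comm, Matrix.mul_assoc,
    Matrix.mul_nonsing_inv _ hD, Matrix.mul_one]

open scoped MatrixOrder in
/-- If a bilinear form is close to the metric on the diagonal, then its trace is close to `n`:
writing `g⁻¹ = BᵀB`, both traces are sums of diagonal values over the rows of `B`. -/
theorem abs_metricTrace_sub_le {g h : Matrix (Fin n) (Fin n) ℝ} (hg : g.PosDef) {δ : ℝ}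
    (hh : ∀ u, |matrixForm h u u - matrixForm g u u| ≤ δ * matrixForm g u u) :
    |metricTrace g h - n| ≤ δ * n := by
  obtain ⟨B, hB⟩ := CStarAlgebra.nonneg_iff_eq_star_mul_self.1 hg.inv.posSemidef.nonneg
  have hrow : ∀ a : Matrix (Fin n) (Fin n) ℝ, metricTrace g a =
      ∑ k, matrixForm a (WithLp.toLp 2 (B k)) (WithLp.toLp 2 (B k)) := by
    intro a
    simp only [metricTrace, hB, Matrix.star_eq_conjTranspose, Matrix.mul_apply, matrixForm_apply, Matrix.conjTranspose_apply,
      star_trivial, Finset.sum_mul]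
    rw [Finset.sum_congr rfl fun i _ => Finset.sum_comm, Finset.sum_comm]
    exact Finset.sum_congr rfl fun k _ => Finset.sum_congr rfl fun i _ =>
      Finset.sum_congr rfl fun j _ => by ring
  have hgg : metricTrace g g = n := by
    have ht : g.transpose = g := by simpa using hg.isHermitian.eq
    rw [metricTrace_eq_trace, ht, Matrix.nonsing_inv_mul _ hg.det_pos.ne'.isUnit]
    simp
  calc |metricTrace g h - n| = |metricTrace g h - metricTrace g g| := by rw [hgg]
    _ = |∑ k, (matrixForm h (WithLp.toLp 2 (B k)) (WithLp.toLp 2 (B k))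
          - matrixForm g (WithLp.toLp 2 (B k)) (WithLp.toLp 2 (B k)))| := by
        rw [hrow, hrow, Finset.sum_sub_distrib]
    _ ≤ ∑ k, δ * matrixForm g (WithLp.toLp 2 (B k)) (WithLp.toLp 2 (B k)) :=
        (Finset.abs_sum_le_sum_abs _ _).trans (Finset.sum_le_sum fun k _ => hh _)
    _ = δ * n := by rw [← Finset.mul_sum, ← hrow, hgg]

end MatrixAlgebra

section Coords

open Filter Topology

variable {n : ℕ} {M : Type*} [TopologicalSpace M] [ChartedSpace (EuclideanSpace ℝ (Fin n)) M]
  [IsManifold (𝓡 n) ∞ M] {φ : OpenPartialHomeomorph M (EuclideanSpace ℝ (Fin n))}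

theorem continuousOn_coords (hφ : φ ∈ atlas (EuclideanSpace ℝ (Fin n)) M) :
    ContinuousOn (fun v : TangentBundle (𝓡 n) M => coords φ v.2)
      (TotalSpace.proj ⁻¹' φ.source) := by
  have h1 : ContMDiffOn (𝓡 n) (𝓡 n) ∞ φ φ.source :=
    contMDiffOn_of_mem_maximalAtlas (IsManifold.subset_maximalAtlas hφ)
  have h2 := h1.continuousOn_tangentMapWithin (by simp) φ.open_source.uniqueMDiffOn
  have h3 := (continuous_snd.comp
    (tangentBundleModelSpaceHomeomorph (𝓡 n)).continuous).comp_continuousOn h2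
  refine ContinuousOn.congr (f := _) h3 fun v hv => ?_
  simp only [Function.comp, tangentMapWithin, coords, tangentBundleModelSpaceHomeomorph_coe]
  rw [mfderivWithin_of_isOpen φ.open_source hv]
  rfl

end Coords

section Invariance

open Filter Topology

theorem contDiffOn_pderiv {n : ℕ} {F : EuclideanSpace ℝ (Fin n) → ℝ}
    {s : Set (EuclideanSpace ℝ (Fin n))} (hF : ContDiffOn ℝ 2 F s) (hs : IsOpen s) (i : Fin n) :
    ContDiffOn ℝ 1 (pderiv i F) s :=
  (hF.fderiv_of_isOpen hs (m := 1) (by norm_num)).clm_apply contDiffOn_const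

variable {n : ℕ} {M : Type*} [TopologicalSpace M] [ChartedSpace (EuclideanSpace ℝ (Fin n)) M]
  [RiemannianBundle (fun x : M => TangentSpace (𝓡 n) x)]

theorem hess_eq_hessForm_chartAt (f : M → ℝ) (x : M) (v w : TangentSpace (𝓡 n) x) :
    hess f x v w = hessForm f (chartAt (EuclideanSpace ℝ (Fin n)) x)
      (chartAt (EuclideanSpace ℝ (Fin n)) x x) (coords (chartAt _ x) v)
      (coords (chartAt _ x) w) := by
  rw [hessForm, matrixForm_apply]
  exact Finset.sum_congr rfl fun i _ => Finset.sum_congr rfl fun j _ => mul_assoc _ _ _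

variable [IsManifold (𝓡 n) ∞ M] [IsContMDiffRiemannianBundle (𝓡 n) 2 (EuclideanSpace ℝ (Fin n))
      (fun x : M => TangentSpace (𝓡 n) x)]
  {φ : OpenPartialHomeomorph M (EuclideanSpace ℝ (Fin n))}

theorem hess_eq_hessForm (hφ : φ ∈ atlas (EuclideanSpace ℝ (Fin n)) M) {f : M → ℝ} {x : M}
    (hx : x ∈ φ.source) (hf : ContMDiffAt (𝓡 n) 𝓘(ℝ) ∞ f x) (v w : TangentSpace (𝓡 n) x) :
    hess f x v w = hessForm f φ (φ x) (coords φ v) (coords φ w) := by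
  have e : φ.symm (φ x) = x := φ.left_inv hx
  have hx' := mem_chart_source (EuclideanSpace ℝ (Fin n)) x
  have hψ := chart_mem_atlas (EuclideanSpace ℝ (Fin n)) x
  have hy : φ x ∈ φ.target ∩ φ.symm ⁻¹' (chartAt (EuclideanSpace ℝ (Fin n)) x).source :=
    ⟨φ.map_source hx, by rwa [mem_preimage, e]⟩
  rw [hessForm_transition hφ hψ hy (by rwa [e]), hess_eq_hessForm_chartAt, Function.comp, e]
  exact congrArg₂ (fun a b => hessForm f (chartAt (EuclideanSpace ℝ (Fin n)) x)
    (chartAt (EuclideanSpace ℝ (Fin n)) x x) a b) (mfderiv_chart_eq hφ hψ hx hx' v)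
    (mfderiv_chart_eq hφ hψ hx hx' w)

theorem laplacian_eq_metricTrace (hφ : φ ∈ atlas (EuclideanSpace ℝ (Fin n)) M) {f : M → ℝ} {x : M}
    (hx : x ∈ φ.source) (hf : ContMDiffAt (𝓡 n) 𝓘(ℝ) ∞ f x) :
    laplacian n f x = metricTrace (metricMatrix φ (φ x)) (Matrix.of (hessMatrix f φ (φ x))) := by
  have e : φ.symm (φ x) = x := φ.left_inv hx
  have hx' := mem_chart_source (EuclideanSpace ℝ (Fin n)) x
  have hψ := chart_mem_atlas (EuclideanSpace ℝ (Fin n)) x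
  have hy : φ x ∈ φ.target ∩ φ.symm ⁻¹' (chartAt (EuclideanSpace ℝ (Fin n)) x).source :=
    ⟨φ.map_source hx, by rwa [mem_preimage, e]⟩
  have hdet : IsUnit (stdMatrix (fderiv ℝ
      (chartAt (EuclideanSpace ℝ (Fin n)) x ∘ φ.symm) (φ x))).det := by
    rw [det_stdMatrix]
    exact (LinearMap.isUnit_iff_isUnit_det _).1
      ((Module.End.isUnit_iff _).2 (bijective_fderiv_transition hφ hψ hy))
  rw [eq_transpose_mul_mul_of_matrixForm (matrixForm_metricMatrix_transition hφ hψ hy),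
    eq_transpose_mul_mul_of_matrixForm (hessForm_transition hφ hψ hy (f := f) (by rwa [e])),
    metricTrace_congruence hdet, Function.comp, e]
  rfl

theorem continuousOn_metricMatrix_inv (hφ : φ ∈ atlas (EuclideanSpace ℝ (Fin n)) M)
    (k l : Fin n) : ContinuousOn (fun y => (metricMatrix φ y)⁻¹ k l) φ.target := by
  have hinv : ContinuousOn (fun y => (metricMatrix φ y)⁻¹) φ.target := by
    intro y hy
    refine ContinuousAt.comp_continuousWithinAt (g := Inv.inv)
      (continuousAt_matrix_inv _ ?_) ?_
    · simpa using continuousAt_inv₀ (posDef_metricMatrix hφ hy).det_pos.ne'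
    · exact continuousWithinAt_pi.2 fun i => continuousWithinAt_pi.2 fun j =>
        (contDiffOn_metricMatrix hφ i j).continuousOn y hy
  exact continuousOn_pi.1 (continuousOn_pi.1 hinv k) l

theorem continuousOn_christoffel (hφ : φ ∈ atlas (EuclideanSpace ℝ (Fin n)) M) (k i j : Fin n) :
    ContinuousOn (fun y => christoffel φ y k i j) φ.target := by
  have hp : ∀ i j k, ContinuousOn (pderiv i fun z => metricMatrix φ z j k) φ.target := fun i j k =>
    (contDiffOn_pderiv (contDiffOn_metricMatrix hφ j k) φ.open_target i).continuousOn
  unfold christoffel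
  exact continuousOn_const.mul (continuousOn_finsetSum _ fun l _ =>
    (continuousOn_metricMatrix_inv hφ k l).mul (((hp i j l).add (hp j i l)).sub (hp l i j)))

theorem continuousOn_hessMatrix (hφ : φ ∈ atlas (EuclideanSpace ℝ (Fin n)) M) {f : M → ℝ}
    (hf : ContDiffOn ℝ ∞ (f ∘ φ.symm) φ.target) (i j : Fin n) :
    ContinuousOn (fun y => hessMatrix f φ y i j) φ.target := by
  have hf2 : ContDiffOn ℝ 2 (f ∘ φ.symm) φ.target := hf.of_le ENat.LEInfty.out
  have h1 : ContDiffOn ℝ 2 (pderiv j (f ∘ φ.symm)) φ.target :=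
    ((hf.of_le (m := 3) ENat.LEInfty.out).fderiv_of_isOpen φ.open_target (m := 2) (by norm_num)).clm_apply contDiffOn_const
  unfold hessMatrix
  exact (contDiffOn_pderiv h1 φ.open_target i).continuousOn.sub
    (continuousOn_finsetSum _ fun k _ => (continuousOn_christoffel hφ k i j).mul
      (contDiffOn_pderiv hf2 φ.open_target k).continuousOn)

theorem continuous_hess {f : M → ℝ} (hf : ContMDiff (𝓡 n) 𝓘(ℝ) ∞ f) :
    Continuous (fun v : TangentBundle (𝓡 n) M => hess f v.1 v.2 v.2) := by
  refine continuous_iff_continuousAt.2 fun v₀ => ?_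
  set φ := chartAt (EuclideanSpace ℝ (Fin n)) v₀.1 with hφd
  have hφ : φ ∈ atlas (EuclideanSpace ℝ (Fin n)) M := chart_mem_atlas _ _
  have hproj : Continuous (TotalSpace.proj : TangentBundle (𝓡 n) M → M) :=
    FiberBundle.continuous_proj _ _
  have hopen : IsOpen (TotalSpace.proj ⁻¹' φ.source : Set (TangentBundle (𝓡 n) M)) :=
    φ.open_source.preimage hproj
  have hH : ContDiffOn ℝ ∞ (f ∘ φ.symm) φ.target := fun y hy =>
    (contDiffAt_comp_symm hφ hy hf.contMDiffAt).contDiffWithinAt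
  have hc : ContinuousOn (fun v : TangentBundle (𝓡 n) M => ∑ i, ∑ j,
      hessMatrix f φ (φ v.1) i j * (coords φ v.2 i * coords φ v.2 j))
      (TotalSpace.proj ⁻¹' φ.source) := by
    have hb : ContinuousOn (fun v : TangentBundle (𝓡 n) M => φ v.1)
        (TotalSpace.proj ⁻¹' φ.source) :=
      φ.continuousOn.comp hproj.continuousOn fun v hv => hv
    have hv : ∀ i, ContinuousOn (fun v : TangentBundle (𝓡 n) M => coords φ v.2 i)
        (TotalSpace.proj ⁻¹' φ.source) := fun i =>
      (EuclideanSpace.proj (𝕜 := ℝ) i).continuous.comp_continuousOn (continuousOn_coords hφ)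
    exact continuousOn_finsetSum _ fun i _ => continuousOn_finsetSum _ fun j _ =>
      ((continuousOn_hessMatrix hφ hH i j).comp hb fun v hv => φ.map_source hv).mul
        ((hv i).mul (hv j))
  refine (hc.congr fun v hv => ?_).continuousAt
    (hopen.mem_nhds (mem_chart_source (EuclideanSpace ℝ (Fin n)) v₀.1))
  simp only [hess_eq_hessForm hφ hv hf.contMDiffAt, hessForm, matrixForm_apply, Matrix.of_apply]

theorem continuous_laplacian {f : M → ℝ} (hf : ContMDiff (𝓡 n) 𝓘(ℝ) ∞ f) :
    Continuous (laplacian n f) := by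
  refine continuous_iff_continuousAt.2 fun x₀ => ?_
  set φ := chartAt (EuclideanSpace ℝ (Fin n)) x₀ with hφd
  have hφ : φ ∈ atlas (EuclideanSpace ℝ (Fin n)) M := chart_mem_atlas _ _
  have hH : ContDiffOn ℝ ∞ (f ∘ φ.symm) φ.target := fun y hy =>
    (contDiffAt_comp_symm hφ hy hf.contMDiffAt).contDiffWithinAt
  have hc : ContinuousOn (fun x => metricTrace (metricMatrix φ (φ x))
      (Matrix.of (hessMatrix f φ (φ x)))) φ.source := by
    unfold metricTrace
    exact continuousOn_finsetSum _ fun i _ => continuousOn_finsetSum _ fun j _ =>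
      ((continuousOn_metricMatrix_inv hφ i j).mul (continuousOn_hessMatrix hφ hH i j)).comp
        φ.continuousOn φ.mapsTo
  exact (hc.congr fun x hx => laplacian_eq_metricTrace hφ hx hf.contMDiffAt).continuousAt
    (φ.open_source.mem_nhds (mem_chart_source (EuclideanSpace ℝ (Fin n)) x₀))

end Invariance

/-! ### The Riemannian volume is locally finite -/

section Volume

open Filter Topology

variable {n : ℕ} {M : Type*} [TopologicalSpace M] [MeasurableSpace M] [BorelSpace M]

theorem measurableSet_target_inter_preimage
    (φ : OpenPartialHomeomorph M (EuclideanSpace ℝ (Fin n))) {A : Set M} (hA : MeasurableSet A) :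
    MeasurableSet (φ.target ∩ φ.symm ⁻¹' A) := by
  have h : Measurable (φ.target.domRestrict φ.symm) :=
    (continuousOn_iff_continuous_domRestrict.1 φ.continuousOn_symm).measurable
  have := (MeasurableEmbedding.subtype_coe φ.open_target.measurableSet).measurableSet_image'
    (h hA)
  convert this using 1
  ext y
  simp [Set.domRestrict, and_comm]

variable [ChartedSpace (EuclideanSpace ℝ (Fin n)) M]
  [RiemannianBundle (fun x : M => TangentSpace (𝓡 n) x)]
  {φ ψ : OpenPartialHomeomorph M (EuclideanSpace ℝ (Fin n))}

theorem chartVol_apply (φ : OpenPartialHomeomorph M (EuclideanSpace ℝ (Fin n))) {A : Set M}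
    (hA : MeasurableSet A) :
    chartVol φ A = ∫⁻ y in φ.target ∩ φ.symm ⁻¹' A,
      ENNReal.ofReal (√(metricMatrix φ y).det) := by
  have h : AEMeasurable φ.symm ((volume.restrict φ.target).withDensity
      fun y => ENNReal.ofReal (√(metricMatrix φ y).det)) :=
    (φ.continuousOn_symm.aemeasurable φ.open_target.measurableSet).mono_ac
      (withDensity_absolutelyContinuous _ _)
  rw [chartVol, Measure.map_apply_of_aemeasurable h hA, withDensity_apply',
    Measure.restrict_restrict' φ.open_target.measurableSet, inter_comm]

variable [IsManifold (𝓡 n) ∞ M]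

/-- Two charts give the same measure on their common domain, by the change of variables formula:
the Gram determinants differ by the square of the Jacobian of the transition map. -/
theorem chartVol_eq_of_subset (hφ : φ ∈ atlas (EuclideanSpace ℝ (Fin n)) M)
    (hψ : ψ ∈ atlas (EuclideanSpace ℝ (Fin n)) M) {A : Set M} (hA : MeasurableSet A)
    (hAs : A ⊆ φ.source ∩ ψ.source) : chartVol ψ A = chartVol φ A := by
  rw [chartVol_apply ψ hA, chartVol_apply φ hA]
  set S := φ.target ∩ φ.symm ⁻¹' A with hS
  have hSt : ∀ y ∈ S, y ∈ φ.target ∩ φ.symm ⁻¹' ψ.source := fun y hy => ⟨hy.1, (hAs hy.2).2⟩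
  have himg : ψ.target ∩ ψ.symm ⁻¹' A = (ψ ∘ φ.symm) '' S := by
    ext z
    constructor
    · rintro ⟨hz, hzA⟩
      have hzs := (hAs hzA).1
      refine ⟨φ (ψ.symm z), ⟨φ.map_source hzs, ?_⟩, ?_⟩
      · rwa [mem_preimage, φ.left_inv hzs]
      · simp [φ.left_inv hzs, ψ.right_inv hz]
    · rintro ⟨y, hy, rfl⟩
      have := (hAs hy.2).2
      refine ⟨ψ.map_source this, ?_⟩
      simpa [ψ.left_inv this] using hy.2
  have hinj : InjOn (ψ ∘ φ.symm) S := fun y hy z hz h =>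
    φ.symm.injOn hy.1 hz.1 (ψ.injOn (hAs hy.2).2 (hAs hz.2).2 h)
  rw [himg, lintegral_image_eq_lintegral_abs_det_fderiv_mul volume
    (measurableSet_target_inter_preimage φ hA)
    (fun y hy => ((contDiffAt_transition hφ hψ (hSt y hy)).differentiableAt
      (by simp)).hasFDerivAt.hasFDerivWithinAt) hinj]
  refine setLIntegral_congr_fun (measurableSet_target_inter_preimage φ hA) fun y hy => ?_
  rw [← ENNReal.ofReal_mul (abs_nonneg _),
    eq_transpose_mul_mul_of_matrixForm (matrixForm_metricMatrix_transition hφ hψ (hSt y hy)),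
    Matrix.det_mul, Matrix.det_mul, Matrix.det_transpose, det_stdMatrix, mul_right_comm, ← sq,
    Real.sqrt_mul (sq_nonneg _), Real.sqrt_sq_eq_abs]

/-- Although the volume is a supremum over the whole, possibly uncountable, atlas, it is at most the
measure of any single chart on the domain of that chart. -/
theorem vol_le_chartVol (hφ : φ ∈ atlas (EuclideanSpace ℝ (Fin n)) M) {A : Set M}
    (hA : MeasurableSet A) (hAs : A ⊆ φ.source) : vol n M A ≤ chartVol φ A := by
  -- `ν` is infinite on every nonempty set outside `φ.source`, so that it dominates every chart
  set ν : Measure M := chartVol φ + (⊤ : ℝ≥0∞) • Measure.count.restrict φ.sourceᶜ with hν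
  have hle : vol n M ≤ ν := by
    refine iSup₂_le fun ψ hψ => Measure.le_iff.2 fun B hB => ?_
    by_cases hBs : B ⊆ φ.source
    · have h1 : chartVol ψ B = chartVol ψ (B ∩ ψ.source) := by
        rw [chartVol_apply ψ hB, chartVol_apply ψ (hB.inter ψ.open_source.measurableSet)]
        congr 2
        ext y
        simp only [mem_inter_iff, mem_preimage, and_congr_right_iff]
        exact fun hy => ⟨fun h => ⟨h, ψ.map_target hy⟩, fun h => h.1⟩
      rw [h1, chartVol_eq_of_subset hφ hψ (hB.inter ψ.open_source.measurableSet)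
        fun x hx => ⟨hBs hx.1, hx.2⟩]
      exact (measure_mono inter_subset_left).trans (by simp [hν])
    · have h0 : Measure.count (B ∩ φ.sourceᶜ) ≠ 0 := by
        rw [ne_eq, Measure.count_eq_zero_iff]
        rw [not_subset] at hBs
        obtain ⟨x, hx, hx'⟩ := hBs
        exact nonempty_iff_ne_empty.1 ⟨x, hx, hx'⟩
      simp [hν, Measure.restrict_apply hB, ENNReal.top_mul h0]
  refine (hle A).trans ?_
  simp [hν, Measure.restrict_apply hA, show A ∩ φ.sourceᶜ = ∅ from
    disjoint_iff_inter_eq_empty.1 (disjoint_compl_right_iff_subset.2 hAs)]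

variable [IsContMDiffRiemannianBundle (𝓡 n) 2 (EuclideanSpace ℝ (Fin n))
      (fun x : M => TangentSpace (𝓡 n) x)]

/-- The volume of a small coordinate ball is finite because the Gram determinant is bounded there. -/
theorem isLocallyFiniteMeasure_vol : IsLocallyFiniteMeasure (vol n M) := by
  refine ⟨fun x => ?_⟩
  set φ := chartAt (EuclideanSpace ℝ (Fin n)) x with hφd
  have hφ : φ ∈ atlas (EuclideanSpace ℝ (Fin n)) M := chart_mem_atlas _ _
  have hx : x ∈ φ.source := mem_chart_source _ _
  have hy : φ x ∈ φ.target := φ.map_source hx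
  have hc : ContinuousAt (fun y => √(metricMatrix φ y).det) (φ x) := by
    refine (ContinuousAt.comp (g := Matrix.det) continuous_id.matrix_det.continuousAt ?_).sqrt
    exact continuousAt_pi.2 fun i => continuousAt_pi.2 fun j =>
      (differentiableAt_metricMatrix hφ hy i j).continuousAt
  set R := √(metricMatrix φ (φ x)).det + 1 with hR
  have h1 : ∀ᶠ y in 𝓝 (φ x), √(metricMatrix φ y).det < R :=
    hc.eventually (gt_mem_nhds (lt_add_one _))
  obtain ⟨r, hr, hball⟩ := Metric.eventually_nhds_iff_ball.1 h1
  set U := φ.source ∩ φ ⁻¹' Metric.ball (φ x) r with hU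
  have hUo : IsOpen U := φ.isOpen_inter_preimage Metric.isOpen_ball
  refine ⟨U, hUo.mem_nhds ⟨hx, Metric.mem_ball_self hr⟩, ?_⟩
  have hsub : φ.target ∩ φ.symm ⁻¹' U ⊆ Metric.ball (φ x) r := fun y hy => by
    simpa [φ.right_inv hy.1] using hy.2.2
  calc vol n M U ≤ chartVol φ U := vol_le_chartVol hφ hUo.measurableSet inter_subset_left
    _ = ∫⁻ y in φ.target ∩ φ.symm ⁻¹' U, ENNReal.ofReal (√(metricMatrix φ y).det) :=
      chartVol_apply φ hUo.measurableSet
    _ ≤ ∫⁻ y in φ.target ∩ φ.symm ⁻¹' U, ENNReal.ofReal R :=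
      setLIntegral_mono measurable_const fun y hy =>
        ENNReal.ofReal_le_ofReal (hball y (hsub hy)).le
    _ ≤ ENNReal.ofReal R * volume (Metric.ball (φ x) r) := by
      rw [setLIntegral_const]
      gcongr
    _ < ⊤ := ENNReal.mul_lt_top ENNReal.ofReal_lt_top measure_ball_lt_top

end Volume

/-! ### Patching local functions on a set of almost full measure -/

section Patching

open Filter Topology TopologicalSpace

/-- A Lindelöf argument. The sets of the cover may be empty, so that `X` itself may be. -/
theorem exists_nat_open_cover {X : Type*} [TopologicalSpace X] [SecondCountableTopology X]
    {P : Set X → Prop} (h0 : P ∅) (h : ∀ x, ∃ U, IsOpen U ∧ x ∈ U ∧ P U) :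
    ∃ U : ℕ → Set X, (∀ i, IsOpen (U i)) ∧ (∀ i, P (U i)) ∧ ⋃ i, U i = univ := by
  choose U hUo hxU hU using h
  obtain ⟨s, hs, hsU⟩ := TopologicalSpace.countable_cover_nhds fun x => (hUo x).mem_nhds (hxU x)
  obtain ⟨g, hg⟩ := ((hs.image U).insert ∅).exists_eq_range (insert_nonempty _ _)
  have hg' : ∀ i, g i = ∅ ∨ ∃ x ∈ s, U x = g i := fun i =>
    (hg ▸ mem_range_self i : g i ∈ insert ∅ (U '' s))
  refine ⟨g, fun i => ?_, fun i => ?_, eq_univ_of_forall fun x => ?_⟩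
  · rcases hg' i with h | ⟨x, -, h⟩
    · exact h ▸ isOpen_empty
    · exact h ▸ hUo x
  · rcases hg' i with h | ⟨x, -, h⟩
    · exact h ▸ h0
    · exact h ▸ hU x
  · obtain ⟨c, hc, hx⟩ := mem_iUnion₂.1 (hsU ▸ mem_univ x)
    obtain ⟨i, hi⟩ : U c ∈ range g := hg ▸ mem_insert_of_mem _ (mem_image_of_mem U hc)
    exact mem_iUnion.2 ⟨i, hi ▸ hx⟩

/-- A locally finite sequence of pairwise disjoint closed sets, subordinate to open sets, can be
thickened to pairwise disjoint closed neighbourhoods. -/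
theorem exists_disjoint_closed_nhds {X : Type*} [TopologicalSpace X] [NormalSpace X]
    {K U : ℕ → Set X} (hK : ∀ i, IsClosed (K i)) (hU : ∀ i, IsOpen (U i)) (hKU : ∀ i, K i ⊆ U i)
    (hfin : LocallyFinite U) (hd : Pairwise fun i j => Disjoint (K i) (K j)) :
    ∃ L : ℕ → Set X, (∀ i, IsClosed (L i)) ∧ (∀ i, K i ⊆ interior (L i)) ∧ (∀ i, L i ⊆ U i) ∧
      Pairwise fun i j => Disjoint (L i) (L j) := by
  have hF : ∀ i, IsClosed (⋃ j : {j // j ≠ i}, K j.1) := fun i =>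
    ((hfin.subset hKU).comp_injective Subtype.val_injective).isClosed_iUnion fun j => hK j.1
  -- `O i` is a neighbourhood of `K i` whose closure misses every other `K j`
  have h1 : ∀ i, ∃ O, IsOpen O ∧ K i ⊆ O ∧ closure O ⊆ U i ∩ (⋃ j : {j // j ≠ i}, K j.1)ᶜ := by
    intro i
    refine normal_exists_closure_subset (hK i) ((hU i).inter (hF i).isOpen_compl)
      (subset_inter (hKU i) fun x hx hx' => ?_)
    obtain ⟨j, hj⟩ := mem_iUnion.1 hx'
    exact (hd j.2).notMem_of_mem_left hj hx
  choose O hOo hKO hO using h1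
  -- `W i` is smaller, and its closure also misses the closures of the earlier `O j`
  have h2 : ∀ i, ∃ W, IsOpen W ∧ K i ⊆ W ∧
      closure W ⊆ O i ∩ (⋃ j ∈ Finset.range i, closure (O j))ᶜ := by
    intro i
    refine normal_exists_closure_subset (hK i) ((hOo i).inter ?_)
      (subset_inter (hKO i) fun x hx hx' => ?_)
    · exact (isClosed_biUnion_finset fun j _ => isClosed_closure).isOpen_compl
    · obtain ⟨j, hj, hxj⟩ := mem_iUnion₂.1 hx'
      exact (hO j hxj).2 (mem_iUnion.2 ⟨⟨i, (Finset.mem_range.1 hj).ne'⟩, hx⟩)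
  choose W hWo hKW hW using h2
  have hlt : ∀ i j, j < i → Disjoint (closure (W i)) (closure (W j)) := fun i j hij =>
    disjoint_left.2 fun x hi hj => (hW i hi).2
      (mem_iUnion₂.2 ⟨j, Finset.mem_range.2 hij, subset_closure (hW j hj).1⟩)
  refine ⟨fun i => closure (W i), fun i => isClosed_closure,
    fun i => (hKW i).trans (interior_maximal subset_closure (hWo i)),
    fun i => (hW i).trans (inter_subset_left.trans (subset_closure.trans
      ((hO i).trans inter_subset_left))), fun i j hij => ?_⟩
  rcases lt_or_gt_of_ne hij with h | h
  · exact (hlt j i h).symm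
  · exact hlt i j h

/-- Every countable open cover has a locally finite family of pairwise disjoint closed sets
subordinate to it whose interiors cover all but an arbitrarily small part of the space: cut the
cover into disjoint Borel pieces, take closed sets that almost fill the pieces, and thicken
them. -/
theorem exists_disjoint_closed_almost_cover {X : Type*} [TopologicalSpace X] [T2Space X]
    [PseudoMetrizableSpace X] [SecondCountableTopology X] [MeasurableSpace X] [BorelSpace X]
    (μ : Measure X) [IsLocallyFiniteMeasure μ] {U : ℕ → Set X} (hU : ∀ i, IsOpen (U i))
    (hcov : ⋃ i, U i = univ) (hfinite : ∀ i, μ (U i) ≠ ⊤) {ε : ℝ≥0∞} (hε : ε ≠ 0) :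
    ∃ L : ℕ → Set X, (∀ i, IsClosed (L i)) ∧ (∀ i, L i ⊆ U i) ∧ LocallyFinite L ∧
      (Pairwise fun i j => Disjoint (L i) (L j)) ∧ μ (⋃ i, interior (L i))ᶜ ≤ ε := by
  let _ := pseudoMetrizableSpacePseudoMetric X
  obtain ⟨V, hVo, hVcov, hVfin, hVU⟩ := precise_refinement U hU hcov
  set A := disjointed V with hA
  have hAm : ∀ i, MeasurableSet (A i) := fun i =>
    MeasurableSet.disjointed (fun j => (hVo j).measurableSet) i
  have hAV : ∀ i, A i ⊆ V i := disjointed_subset V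
  obtain ⟨δ, hδ, hsum⟩ := ENNReal.exists_pos_sum_of_countable' hε ℕ
  have h1 : ∀ i, ∃ K ⊆ A i, IsClosed K ∧ μ (A i \ K) < δ i := fun i =>
    (hAm i).exists_isClosed_sdiff_lt
      (measure_ne_top_of_subset ((hAV i).trans (hVU i)) (hfinite i)) (hδ i).ne'
  choose K hKA hK hKδ using h1
  obtain ⟨L, hL, hKL, hLV, hLd⟩ := exists_disjoint_closed_nhds hK hVo
    (fun i => (hKA i).trans (hAV i)) hVfin
    fun i j hij => (disjoint_disjointed V hij).mono (hKA i) (hKA j)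
  refine ⟨L, hL, fun i => (hLV i).trans (hVU i), hVfin.subset hLV, hLd, ?_⟩
  have hsub : (⋃ i, interior (L i))ᶜ ⊆ ⋃ i, A i \ K i := by
    intro x hx
    have hxA : x ∈ ⋃ i, A i := by rw [hA, iUnion_disjointed, hVcov]; trivial
    obtain ⟨i, hi⟩ := mem_iUnion.1 hxA
    exact mem_iUnion.2 ⟨i, hi, fun hxK => hx (mem_iUnion.2 ⟨i, hKL i hxK⟩)⟩
  calc μ (⋃ i, interior (L i))ᶜ ≤ μ (⋃ i, A i \ K i) := measure_mono hsub
    _ ≤ ∑' i, μ (A i \ K i) := measure_iUnion_le _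
    _ ≤ ∑' i, δ i := ENNReal.tsum_le_tsum fun i => (hKδ i).le
    _ ≤ ε := hsum.le

/-- Functions given near the members of a locally finite family of disjoint closed sets extend to one
smooth function: the condition of being equal to `h i` on `L i` is convex, and it has local solutions
since a point lies in at most one `L i` and has a neighbourhood that misses the others. -/
theorem exists_contMDiff_eqOn_of_disjoint {n : ℕ} {M : Type*} [TopologicalSpace M] [T2Space M]
    [SecondCountableTopology M] [ChartedSpace (EuclideanSpace ℝ (Fin n)) M]
    [IsManifold (𝓡 n) ∞ M] {L U : ℕ → Set M} {h : ℕ → M → ℝ} (hL : ∀ i, IsClosed (L i))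
    (hU : ∀ i, IsOpen (U i)) (hLU : ∀ i, L i ⊆ U i) (hfin : LocallyFinite L)
    (hd : Pairwise fun i j => Disjoint (L i) (L j))
    (hh : ∀ i, ContMDiffOn (𝓡 n) 𝓘(ℝ) ∞ (h i) (U i)) :
    ∃ f : M → ℝ, ContMDiff (𝓡 n) 𝓘(ℝ) ∞ f ∧ ∀ i, EqOn f (h i) (L i) := by
  have : LocallyCompactSpace M :=
    ChartedSpace.locallyCompactSpace (EuclideanSpace ℝ (Fin n)) M
  have hF : ∀ s : Set ℕ, IsClosed (⋃ j : s, L j) := fun s =>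
    (hfin.comp_injective Subtype.val_injective).isClosed_iUnion fun j => hL j.1
  obtain ⟨g, hg⟩ := exists_contMDiffMap_forall_mem_convex_of_local (n := ⊤) (𝓡 n)
    (t := fun x => {r : ℝ | ∀ i, x ∈ L i → r = h i x})
    (fun x r hr r' hr' a b _ _ hab i hi => by
      rw [hr i hi, hr' i hi, ← add_smul, hab, one_smul])
    (fun x => by
      by_cases hx : ∃ i, x ∈ L i
      · obtain ⟨i, hi⟩ := hx
        refine ⟨U i ∩ (⋃ j : ({i}ᶜ : Set ℕ), L j)ᶜ,
          ((hU i).inter (hF _).isOpen_compl).mem_nhds ⟨hLU i hi, fun hx => ?_⟩, h i,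
          (hh i).mono inter_subset_left, fun y hy j hj => ?_⟩
        · obtain ⟨j, hj⟩ := mem_iUnion.1 hx
          exact (hd j.2).notMem_of_mem_left hj hi
        · by_cases hji : j = i
          · rw [hji]
          · exact (hy.2 (mem_iUnion.2 ⟨⟨j, hji⟩, hj⟩)).elim
      · refine ⟨(⋃ j : (univ : Set ℕ), L j)ᶜ, (hF _).isOpen_compl.mem_nhds fun hx' => ?_, 0,
          contMDiffOn_const, fun y hy j hj => ?_⟩
        · obtain ⟨j, hj⟩ := mem_iUnion.1 hx'
          exact hx ⟨j, hj⟩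
        · exact (hy (mem_iUnion.2 ⟨⟨j, trivial⟩, hj⟩)).elim)
  exact ⟨g, g.contMDiff, fun i x hx => hg x i hx⟩

end Patching

/-! ### Local functions with prescribed gradient and Hessian at a point -/

section Quadratic

open Filter Topology

variable {E : Type*} [NormedAddCommGroup E] [NormedSpace ℝ E]

/-- The quadratic polynomial with differential `ℓ` and second derivative the symmetric part of `Q`
at `y₀`. -/
noncomputable def quadPoly (ℓ : StrongDual ℝ E) (Q : BilinForm E) (y₀ y : E) : ℝ :=
  ℓ (y - y₀) + 1 / 2 * Q (y - y₀) (y - y₀)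

theorem contDiff_quadPoly (ℓ : StrongDual ℝ E) (Q : BilinForm E) (y₀ : E) :
    ContDiff ℝ ∞ (quadPoly ℓ Q y₀) := by
  have h : ContDiff ℝ ∞ fun y : E => y - y₀ := contDiff_id.sub contDiff_const
  exact (ℓ.contDiff.comp h).add (contDiff_const.mul ((Q.contDiff.comp h).clm_apply h))

theorem hasFDerivAt_quadPoly (ℓ : StrongDual ℝ E) (Q : BilinForm E) (y₀ y : E) :
    HasFDerivAt (quadPoly ℓ Q y₀)
      (ℓ + (1 / 2 : ℝ) • (Q (y - y₀) + Q.flip (y - y₀))) y := by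
  have h : HasFDerivAt (fun y : E => y - y₀) (ContinuousLinearMap.id ℝ E) y :=
    (hasFDerivAt_id y).sub_const y₀
  have h2 := (HasFDerivAt.comp (g := Q) y Q.hasFDerivAt h).clm_apply h
  refine ((HasFDerivAt.comp (g := ℓ) y ℓ.hasFDerivAt h).add (h2.const_mul (1 / 2))).congr_fderiv ?_
  ext v
  simp

theorem fderiv_quadPoly (ℓ : StrongDual ℝ E) (Q : BilinForm E) (y₀ : E) :
    fderiv ℝ (quadPoly ℓ Q y₀) y₀ = ℓ := by
  rw [(hasFDerivAt_quadPoly ℓ Q y₀ y₀).fderiv]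
  simp

set_option synthInstance.maxHeartbeats 100000 in
theorem fderiv_fderiv_quadPoly_self (ℓ : StrongDual ℝ E) (Q : BilinForm E) (y₀ u : E) :
    fderiv ℝ (fderiv ℝ (quadPoly ℓ Q y₀)) y₀ u u = Q u u := by
  have h : HasFDerivAt (fun y : E => y - y₀) (ContinuousLinearMap.id ℝ E) y₀ :=
    (hasFDerivAt_id y₀).sub_const y₀
  have h1 : fderiv ℝ (quadPoly ℓ Q y₀) =
      fun y => ℓ + (1 / 2 : ℝ) • (Q (y - y₀) + Q.flip (y - y₀)) :=
    funext fun y => (hasFDerivAt_quadPoly ℓ Q y₀ y).fderiv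
  have hQ := HasFDerivAt.comp (g := Q) y₀ Q.hasFDerivAt h
  have hQ' := HasFDerivAt.comp (g := Q.flip) y₀ Q.flip.hasFDerivAt h
  have h2 : HasFDerivAt (fun y => ℓ + (1 / 2 : ℝ) • (Q (y - y₀) + Q.flip (y - y₀)))
      ((1 / 2 : ℝ) • (Q.comp (ContinuousLinearMap.id ℝ E)
        + Q.flip.comp (ContinuousLinearMap.id ℝ E))) y₀ :=
    ((hQ.add hQ').const_smul (1 / 2 : ℝ)).const_add ℓ
  rw [h1, h2.fderiv]
  simp
  ring

end Quadratic

section Comparison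

open Filter Topology

theorem continuousAt_matrixForm_diag {n : ℕ} {Y : Type*} [TopologicalSpace Y]
    {A : Y → Matrix (Fin n) (Fin n) ℝ} {y₀ : Y} (hA : ∀ i j, ContinuousAt (fun y => A y i j) y₀)
    (u : EuclideanSpace ℝ (Fin n)) :
    ContinuousAt (fun z : Y × EuclideanSpace ℝ (Fin n) => matrixForm (A z.1) z.2 z.2) (y₀, u) := by
  simp only [matrixForm_apply]
  refine tendsto_finsetSum _ fun i _ => tendsto_finsetSum _ fun j _ => ?_
  have h1 : ContinuousAt (fun z : Y × EuclideanSpace ℝ (Fin n) => A z.1 i j) (y₀, u) :=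
    ContinuousAt.comp (g := fun y => A y i j) (hA i j) continuousAt_fst
  have h2 : ∀ i, ContinuousAt (fun z : Y × EuclideanSpace ℝ (Fin n) => z.2 i) (y₀, u) := fun i =>
    ((EuclideanSpace.proj (𝕜 := ℝ) i).continuous.comp continuous_snd).continuousAt
  exact h1.mul ((h2 i).mul (h2 j))

/-- A strict comparison of quadratic forms at a point persists nearby, uniformly over all vectors,
by compactness of the unit sphere. -/
theorem eventually_abs_matrixForm_sub_le {n : ℕ} {Y : Type*} [TopologicalSpace Y]
    {A B : Y → Matrix (Fin n) (Fin n) ℝ} {y₀ : Y} {δ : ℝ}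
    (hA : ∀ i j, ContinuousAt (fun y => A y i j) y₀)
    (hB : ∀ i j, ContinuousAt (fun y => B y i j) y₀)
    (h : ∀ u, u ≠ 0 →
      |matrixForm (A y₀) u u - matrixForm (B y₀) u u| < δ * matrixForm (B y₀) u u) :
    ∀ᶠ y in 𝓝 y₀, ∀ u,
      |matrixForm (A y) u u - matrixForm (B y) u u| ≤ δ * matrixForm (B y) u u := by
  have h1 : ∀ᶠ y in 𝓝 y₀, ∀ u ∈ Metric.sphere (0 : EuclideanSpace ℝ (Fin n)) 1,
      |matrixForm (A y) u u - matrixForm (B y) u u| < δ * matrixForm (B y) u u := by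
    refine (isCompact_sphere _ _).eventually_forall_of_forall_eventually fun u hu => ?_
    have hA' := continuousAt_matrixForm_diag hA u
    have hB' := continuousAt_matrixForm_diag hB u
    refine ContinuousAt.eventually_lt (hA'.sub hB').abs (continuousAt_const.mul hB') (h u ?_)
    rintro rfl
    simp at hu
  filter_upwards [h1] with y hy u
  rcases eq_or_ne u 0 with rfl | hu
  · simp
  have hn : 0 < ‖u‖ := norm_pos_iff.2 hu
  have hs := (hy (‖u‖⁻¹ • u) (by simp [norm_smul, hn.ne'])).le
  simp only [map_smul, smul_apply, smul_eq_mul] at hs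
  have hp : 0 < ‖u‖⁻¹ * ‖u‖⁻¹ := by positivity
  have e : ∀ a b : ℝ, ‖u‖⁻¹ * (‖u‖⁻¹ * a) - ‖u‖⁻¹ * (‖u‖⁻¹ * b) = ‖u‖⁻¹ * ‖u‖⁻¹ * (a - b) :=
    fun a b => by ring
  rw [e, abs_mul, abs_of_pos hp] at hs
  refine le_of_mul_le_mul_left (hs.trans_eq ?_) hp
  ring

end Comparison

section Adapted

open Filter Topology

variable {n : ℕ} {M : Type*} [TopologicalSpace M] [ChartedSpace (EuclideanSpace ℝ (Fin n)) M]

theorem hessMatrix_congr [RiemannianBundle (fun x : M => TangentSpace (𝓡 n) x)] {f h : M → ℝ}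
    {φ : OpenPartialHomeomorph M (EuclideanSpace ℝ (Fin n))}
    {y : EuclideanSpace ℝ (Fin n)} (hfh : f ∘ φ.symm =ᶠ[𝓝 y] h ∘ φ.symm) :
    hessMatrix f φ y = hessMatrix h φ y := by
  have h1 : ∀ i, pderiv i (f ∘ φ.symm) =ᶠ[𝓝 y] pderiv i (h ∘ φ.symm) := fun i => by
    filter_upwards [hfh.eventuallyEq_nhds] with z hz
    rw [pderiv, pderiv, hz.fderiv_eq]
  ext i j
  have h2 : secondPartial f φ y i j = secondPartial h φ y i j := by
    rw [secondPartial, secondPartial, pderiv, pderiv, (h1 j).fderiv_eq]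
  rw [hessMatrix, hessMatrix, h2]
  exact congrArg _ (Finset.sum_congr rfl fun k _ => by rw [(h1 k).self_of_nhds])

theorem mvfderiv_coordVec [IsManifold (𝓡 n) ∞ M]
    {φ : OpenPartialHomeomorph M (EuclideanSpace ℝ (Fin n))}
    (hφ : φ ∈ atlas (EuclideanSpace ℝ (Fin n)) M) {y : EuclideanSpace ℝ (Fin n)}
    (hy : y ∈ φ.target) {f : M → ℝ} (hf : ContMDiffAt (𝓡 n) 𝓘(ℝ) ∞ f (φ.symm y)) (i : Fin n) :
    mvfderiv (𝓡 n) f (φ.symm y) (coordVec φ y i) = pderiv i (f ∘ φ.symm) y := by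
  have h1 : MDifferentiableAt (𝓡 n) 𝓘(ℝ) f (φ.symm y) := hf.mdifferentiableAt (by simp)
  have h2 : MDifferentiableAt (𝓡 n) (𝓡 n) φ.symm y := mdifferentiableAt_atlas_symm hφ hy
  have h3 : (fderiv ℝ (f ∘ φ.symm) y : _ → ℝ) =
      fun v => mfderiv (𝓡 n) 𝓘(ℝ) f (φ.symm y) (mfderiv (𝓡 n) (𝓡 n) φ.symm y v) := by
    rw [← mfderiv_eq_fderiv, mfderiv_comp y h1 h2]
    rfl
  exact (congrFun h3 _).symm

variable [RiemannianBundle (fun x : M => TangentSpace (𝓡 n) x)]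

theorem inner_grad (f : M → ℝ) (x : M) (v : TangentSpace (𝓡 n) x) :
    inner ℝ (grad n f x) v = mvfderiv (𝓡 n) f x v := by
  have : FiniteDimensional ℝ (TangentSpace (𝓡 n) x) :=
    inferInstanceAs (FiniteDimensional ℝ (EuclideanSpace ℝ (Fin n)))
  have : CompleteSpace (TangentSpace (𝓡 n) x) := FiniteDimensional.complete ℝ _
  exact InnerProductSpace.toDual_symm_apply

variable (n) in
/-- `f` is adapted to the metric at `x` if `Hess f` is within a quarter of the metric at `x` and
`|∇f| ≥ 1/2` there. -/
def IsAdapted (f : M → ℝ) (x : M) : Prop :=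
  (∀ v : TangentSpace (𝓡 n) x, |hess f x v v - ‖v‖ ^ 2| ≤ 1 / 4 * ‖v‖ ^ 2) ∧
    1 / 2 ≤ ‖grad n f x‖

variable [IsManifold (𝓡 n) ∞ M] [IsContMDiffRiemannianBundle (𝓡 n) 2 (EuclideanSpace ℝ (Fin n))
      (fun x : M => TangentSpace (𝓡 n) x)]

theorem isAdapted_of_chart {φ : OpenPartialHomeomorph M (EuclideanSpace ℝ (Fin n))}
    (hφ : φ ∈ atlas (EuclideanSpace ℝ (Fin n)) M) {x : M} (hx : x ∈ φ.source) {f : M → ℝ}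
    (hf : ContMDiffAt (𝓡 n) 𝓘(ℝ) ∞ f x)
    (hH : ∀ u, |hessForm f φ (φ x) u u - matrixForm (metricMatrix φ (φ x)) u u| ≤
      1 / 4 * matrixForm (metricMatrix φ (φ x)) u u)
    {i : Fin n}
    (hg : √(metricMatrix φ (φ x) i i) ≤ 2 * pderiv i (f ∘ φ.symm) (φ x)) :
    IsAdapted n f x := by
  refine ⟨fun v => ?_, ?_⟩
  · rw [hess_eq_hessForm hφ hx hf, ← real_inner_self_eq_norm_sq,
      ← matrixForm_metricMatrix_coords hφ hx]
    exact hH _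
  -- Cauchy-Schwarz for the gradient and the coordinate vector `∂ᵢ`, of length `√gᵢᵢ`
  · have hy : φ x ∈ φ.target := φ.map_source hx
    obtain ⟨y, hyd⟩ : ∃ y, y = φ x := ⟨_, rfl⟩
    obtain rfl : φ.symm y = x := by rw [hyd, φ.left_inv hx]
    rw [← hyd] at hy hg
    have hpos : 0 < metricMatrix φ y i i := (posDef_metricMatrix hφ hy).diag_pos
    have hn : ‖coordVec φ y i‖ = √(metricMatrix φ y i i) := by
      rw [← Real.sqrt_sq (norm_nonneg (coordVec φ y i)), ← real_inner_self_eq_norm_sq]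
      rfl
    have h1 : pderiv i (f ∘ φ.symm) y ≤ ‖grad n f (φ.symm y)‖ * √(metricMatrix φ y i i) := by
      rw [← mvfderiv_coordVec hφ hy hf, ← inner_grad, ← hn]
      exact real_inner_le_norm _ _
    nlinarith [Real.sqrt_pos.2 hpos]

/-- Near every point there is a smooth function adapted to the metric. In coordinates it is a
quadratic polynomial `ℓ + Q/2` at `y₀`, where `ℓ` has norm one at `y₀` and `Q` is the sum of the
metric and of the Christoffel term `ℓ(Γ)`, so that its Hessian at `y₀` equals the metric. -/
theorem exists_isAdapted_nhds [NeZero n] (p : M) :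
    ∃ U : Set M, IsOpen U ∧ p ∈ U ∧ ∃ h : M → ℝ, ContMDiffOn (𝓡 n) 𝓘(ℝ) ∞ h U ∧
      ∀ f : M → ℝ, ∀ x ∈ U, f =ᶠ[𝓝 x] h → IsAdapted n f x := by
  set φ := chartAt (EuclideanSpace ℝ (Fin n)) p with hφd
  have hφ : φ ∈ atlas (EuclideanSpace ℝ (Fin n)) M := chart_mem_atlas _ _
  have hp : p ∈ φ.source := mem_chart_source _ _
  set y₀ := φ p with hy₀
  have hy : y₀ ∈ φ.target := φ.map_source hp
  set s := √(metricMatrix φ y₀ 0 0) with hs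
  have hs0 : 0 < s := Real.sqrt_pos.2 (posDef_metricMatrix hφ hy).diag_pos
  set ℓ : StrongDual ℝ (EuclideanSpace ℝ (Fin n)) := s • EuclideanSpace.proj (𝕜 := ℝ) 0 with hℓ
  have hℓv : ∀ v, ℓ v = s * v 0 := fun v => rfl
  set a : Matrix (Fin n) (Fin n) ℝ :=
    Matrix.of fun i j => metricMatrix φ y₀ i j + s * christoffel φ y₀ 0 i j with ha
  set F := quadPoly ℓ (matrixForm a) y₀ with hF
  set h : M → ℝ := F ∘ φ with hh
  have hFs : ContDiff ℝ ∞ F := contDiff_quadPoly _ _ _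
  have hhF : ∀ y ∈ φ.target, h ∘ φ.symm =ᶠ[𝓝 y] F := fun y hy => by
    filter_upwards [φ.open_target.mem_nhds hy] with z hz
    simp [hh, φ.right_inv hz]
  have hhc : ContDiffOn ℝ ∞ (h ∘ φ.symm) φ.target :=
    hFs.contDiffOn.congr fun y hy => (hhF y hy).self_of_nhds
  have hhs : ContMDiffOn (𝓡 n) 𝓘(ℝ) ∞ h φ.source :=
    hFs.contMDiff.comp_contMDiffOn
      (contMDiffOn_of_mem_maximalAtlas (IsManifold.subset_maximalAtlas hφ))
  have hHc : ∀ i j, ContinuousAt (fun y => Matrix.of (hessMatrix h φ y) i j) y₀ := fun i j =>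
    (continuousOn_hessMatrix hφ hhc i j).continuousAt (φ.open_target.mem_nhds hy)
  have hgc : ∀ i j, ContinuousAt (fun y => metricMatrix φ y i j) y₀ := fun i j =>
    (differentiableAt_metricMatrix hφ hy i j).continuousAt
  have hH0 : ∀ u, hessForm h φ y₀ u u = matrixForm (metricMatrix φ y₀) u u := by
    intro u
    rw [hessForm_eq_fderiv ((hhc.contDiffAt (φ.open_target.mem_nhds hy)).of_le
      ENat.LEInfty.out), (hhF y₀ hy).fderiv.fderiv_eq, (hhF y₀ hy).fderiv_eq, hF,
      fderiv_fderiv_quadPoly_self, fderiv_quadPoly, matrixForm_apply, matrixForm_apply]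
    simp only [hℓv, christoffelVec, Finset.mul_sum, ← Finset.sum_sub_distrib]
    refine Finset.sum_congr rfl fun i _ => Finset.sum_congr rfl fun j _ => ?_
    rw [ha, Matrix.of_apply]
    ring
  have hev1 := eventually_abs_matrixForm_sub_le (δ := 1 / 4) hHc hgc fun u hu => by
    have h1 := matrixForm_metricMatrix_self_pos hφ hy hu
    rw [show matrixForm (Matrix.of (hessMatrix h φ y₀)) u u = _ from hH0 u, sub_self, abs_zero]
    positivity
  have hev2 : ∀ᶠ y in 𝓝 y₀, √(metricMatrix φ y 0 0) < 2 * pderiv 0 (h ∘ φ.symm) y := by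
    refine ContinuousAt.eventually_lt (hgc 0 0).sqrt (continuousAt_const.mul
      ((contDiffOn_pderiv (hhc.of_le ENat.LEInfty.out) φ.open_target 0).continuousOn.continuousAt
        (φ.open_target.mem_nhds hy))) ?_
    rw [pderiv, (hhF y₀ hy).fderiv_eq, hF, fderiv_quadPoly]
    rw [hℓv, PiLp.single_apply, if_pos rfl]
    linarith
  obtain ⟨N, hN, hNo, hyN⟩ := eventually_nhds_iff.1 (hev1.and hev2)
  refine ⟨φ.source ∩ φ ⁻¹' N, φ.isOpen_inter_preimage hNo, ⟨hp, hyN⟩, h,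
    hhs.mono inter_subset_left, fun f x hx hfx => ?_⟩
  have hxs : x ∈ φ.source := hx.1
  have hfh : f ∘ φ.symm =ᶠ[𝓝 (φ x)] h ∘ φ.symm := by
    have hc := φ.continuousAt_symm (φ.map_source hxs)
    rw [ContinuousAt, φ.left_inv hxs] at hc
    exact hc.eventually hfx
  have hf : ContMDiffAt (𝓡 n) 𝓘(ℝ) ∞ f x :=
    (hhs.contMDiffAt (φ.open_source.mem_nhds hxs)).congr_of_eventuallyEq hfx
  refine isAdapted_of_chart hφ hxs hf (fun u => ?_) (i := 0) ?_
  · rw [hessForm, hessMatrix_congr hfh]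
    exact (hN _ hx.2).1 u
  · rw [pderiv, hfh.fderiv_eq]
    exact (hN _ hx.2).2.le

end Adapted

/-! ### The multiplier inequality for an adapted function -/

section Multiplier

open Filter Topology

variable {n : ℕ} {M : Type*} [TopologicalSpace M] [ChartedSpace (EuclideanSpace ℝ (Fin n)) M]
  [RiemannianBundle (fun x : M => TangentSpace (𝓡 n) x)] [IsManifold (𝓡 n) ∞ M]

/-- The trace of a form that is within a quarter of the metric is within `n / 4` of `n`. -/
theorem IsAdapted.abs_laplacian_sub_le {f : M → ℝ} {x : M} (h : IsAdapted n f x) :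
    |laplacian n f x - n| ≤ 1 / 4 * n := by
  have hφ := chart_mem_atlas (EuclideanSpace ℝ (Fin n)) x
  have hx := mem_chart_source (EuclideanSpace ℝ (Fin n)) x
  refine abs_metricTrace_sub_le (posDef_metricMatrix hφ ((chartAt _ x).map_source hx)) fun u => ?_
  obtain ⟨v, hv⟩ : ∃ v : TangentSpace (𝓡 n) x, coords (chartAt _ x) v = u :=
    (mdifferentiable_of_mem_atlas (I := 𝓡 n) hφ).mfderiv_surjective hx u
  have h1 := h.1 v
  rw [← real_inner_self_eq_norm_sq, ← matrixForm_metricMatrix_coords hφ hx,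
    hess_eq_hessForm_chartAt, hv] at h1
  exact h1

variable [IsContMDiffRiemannianBundle (𝓡 n) 2 (EuclideanSpace ℝ (Fin n))
      (fun x : M => TangentSpace (𝓡 n) x)]

/-- `Hess f(w, w)` is measurable for a measurable field `w` of tangent vectors. As in
`AEStronglyMeasurable`, the σ-algebra `m` need not be the one of the measure. -/
theorem aestronglyMeasurable_hess {α : Type*} {m m₀ : MeasurableSpace α} {ν : @Measure α m₀} {f : M → ℝ}
    (hf : ContMDiff (𝓡 n) 𝓘(ℝ) ∞ f) {w : α → TangentBundle (𝓡 n) M}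
    (hw : AEStronglyMeasurable[m] w ν) :
    AEStronglyMeasurable[m] (fun a => hess f (w a).1 (w a).2 (w a).2) ν :=
  Continuous.comp_aestronglyMeasurable (g := fun v : TangentBundle (𝓡 n) M => hess f v.1 v.2 v.2) (continuous_hess hf) hw

end Multiplier

section MultiplierInequality

open Filter Topology

variable {M : Type*} [TopologicalSpace M] [SecondCountableTopology M]
    [MeasurableSpace M] [BorelSpace M]
    [ChartedSpace (EuclideanSpace ℝ (Fin 2)) M] [IsManifold (𝓡 2) ∞ M]
    [RiemannianBundle (fun x : M => TangentSpace (𝓡 2) x)]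
    [IsContMDiffRiemannianBundle (𝓡 2) 2 (EuclideanSpace ℝ (Fin 2))
      (fun x : M => TangentSpace (𝓡 2) x)]

/-- In dimension two an adapted function has `Hess f ≥ 3/4` and `3/4 ≤ Δf/2 ≤ 5/4`. With
`α = 5/8` both coefficients of the integrand are then at least `1/8`. -/
theorem multiplierInequality_of_isAdapted {f : M → ℝ} (hf : ContMDiff (𝓡 2) 𝓘(ℝ) ∞ f) {V : Set M}
    (hV : IsOpen V) (hfV : ∀ x ∈ V, IsAdapted 2 f x) {T : ℝ} {u ut : ℝ × M → ℝ}
    {du : (z : ℝ × M) → TangentSpace (𝓡 2) z.2} (hu : IsH1 T u ut du) :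
    MultiplierInequality f V (1 / 8) (5 / 8) T ut du := by
  have := isLocallyFiniteMeasure_vol (n := 2) (M := M)
  set μ : Measure (ℝ × M) := (volume : Measure ℝ).prod (vol 2 M) with hμ
  have hms : MeasurableSet (Ioo 0 T ×ˢ V) := measurableSet_Ioo.prod hV.measurableSet
  have hle : μ.restrict (Ioo 0 T ×ˢ V) ≤ (volume.restrict (Ioo 0 T)).prod (vol 2 M) := by
    conv_rhs => rw [← Measure.restrict_univ (μ := vol 2 M), Measure.prod_restrict]
    exact Measure.restrict_mono (prod_mono le_rfl (subset_univ _)) le_rfl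
  have hdu : IntegrableOn (fun z => ‖du z‖ ^ 2) (Ioo 0 T ×ˢ V) μ :=
    hu.integrable_grad.mono_measure hle
  have hut : IntegrableOn (fun z => ut z ^ 2) (Ioo 0 T ×ˢ V) μ :=
    hu.memLp_time.integrable_sq.mono_measure hle
  have hsum : IntegrableOn (fun z => ‖du z‖ ^ 2 + ut z ^ 2) (Ioo 0 T ×ˢ V) μ := hdu.add hut
  have hhess : AEStronglyMeasurable (fun z : ℝ × M => hess f z.2 (du z) (du z))
      (μ.restrict (Ioo 0 T ×ˢ V)) := by
    have h := aestronglyMeasurable_hess hf hu.aestronglyMeasurable_grad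
    exact h.mono_measure hle
  have hlap : Continuous (fun z : ℝ × M => laplacian 2 f z.2) :=
    (continuous_laplacian hf).comp continuous_snd
  have hbound : ∀ z ∈ Ioo 0 T ×ˢ V,
      |hess f z.2 (du z) (du z) - ‖du z‖ ^ 2| ≤ 1 / 4 * ‖du z‖ ^ 2 ∧
        3 / 2 ≤ laplacian 2 f z.2 ∧ laplacian 2 f z.2 ≤ 5 / 2 := by
    intro z hz
    have h := hfV z.2 hz.2
    have h2 := abs_le.1 h.abs_laplacian_sub_le
    push_cast at h2
    exact ⟨h.1 _, by linarith [h2.1], by linarith [h2.2]⟩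
  have hint : IntegrableOn (fun z : ℝ × M => hess f z.2 (du z) (du z)
      + (5 / 8 - laplacian 2 f z.2 / 2) * ‖du z‖ ^ 2
      + (laplacian 2 f z.2 / 2 - 5 / 8) * ut z ^ 2) (Ioo 0 T ×ˢ V) μ := by
    refine Integrable.mono' (hsum.const_mul 2) ?_ ?_
    · have h1 : AEStronglyMeasurable (fun z : ℝ × M => 5 / 8 - laplacian 2 f z.2 / 2)
          (μ.restrict (Ioo 0 T ×ˢ V)) :=
        (continuous_const.sub (hlap.div_const 2)).aestronglyMeasurable
      have h2 : AEStronglyMeasurable (fun z : ℝ × M => laplacian 2 f z.2 / 2 - 5 / 8)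
          (μ.restrict (Ioo 0 T ×ˢ V)) :=
        ((hlap.div_const 2).sub continuous_const).aestronglyMeasurable
      exact (hhess.fun_add (h1.fun_mul hdu.aestronglyMeasurable)).fun_add
        (h2.fun_mul hut.aestronglyMeasurable)
    · refine ae_restrict_of_forall_mem hms fun z hz => ?_
      obtain ⟨h1, h2, h3⟩ := hbound z hz
      obtain ⟨h4, h5⟩ := abs_le.1 h1
      have h6 := sq_nonneg ‖du z‖
      have h7 := sq_nonneg (ut z)
      rw [Real.norm_eq_abs, abs_le]
      constructor <;> nlinarith
  refine ⟨hint, ?_⟩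
  rw [← integral_const_mul]
  refine setIntegral_mono_on (hsum.const_mul _) hint hms fun z hz => ?_
  obtain ⟨h1, h2, h3⟩ := hbound z hz
  obtain ⟨h4, -⟩ := abs_le.1 h1
  have h6 := sq_nonneg ‖du z‖
  have h7 := sq_nonneg (ut z)
  nlinarith

end MultiplierInequality

end Riem

theorem mainTheorem3 {M : Type*} [TopologicalSpace M] [T2Space M] [SecondCountableTopology M]
    [MeasurableSpace M] [BorelSpace M]
    [ChartedSpace (EuclideanSpace ℝ (Fin 2)) M] [IsManifold (𝓡 2) ∞ M]
    [RiemannianBundle (fun x : M => TangentSpace (𝓡 2) x)]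
    [IsContMDiffRiemannianBundle (𝓡 2) 2 (EuclideanSpace ℝ (Fin 2))
      (fun x : M => TangentSpace (𝓡 2) x)]
    (ε : ℝ) (hε : 0 < ε) :
    ∃ (f : M → ℝ) (V : Set M), ContMDiff (𝓡 2) 𝓘(ℝ) ∞ f ∧ IsOpen V ∧
      Riem.vol 2 M univ ≤ Riem.vol 2 M V + ENNReal.ofReal ε ∧
      (∃ C α : ℝ, 0 < C ∧
        ∀ (T : ℝ), 0 < T → ∀ (u ut : ℝ × M → ℝ) (du : (z : ℝ × M) → TangentSpace (𝓡 2) z.2),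
          Riem.IsH1 T u ut du → Riem.MultiplierInequality f V C α T ut du) ∧
      (∃ c : ℝ, 0 < c ∧ ∀ x ∈ V, c ≤ ‖Riem.grad 2 f x‖) := by
  have hvol := Riem.isLocallyFiniteMeasure_vol (n := 2) (M := M)
  have : LocallyCompactSpace M :=
    ChartedSpace.locallyCompactSpace (EuclideanSpace ℝ (Fin 2)) M
  -- a countable cover by sets of finite volume that carry adapted functions
  obtain ⟨U, hUo, hU, hcov⟩ := Riem.exists_nat_open_cover
    (P := fun U : Set M => Riem.vol 2 M U ≠ ⊤ ∧ ∃ h : M → ℝ, ContMDiffOn (𝓡 2) 𝓘(ℝ) ∞ h U ∧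
      ∀ f : M → ℝ, ∀ x ∈ U, f =ᶠ[nhds x] h → Riem.IsAdapted 2 f x)
    ⟨by simp, 0, contMDiffOn_const, fun f x hx => hx.elim⟩ fun x => by
      obtain ⟨W, hWo, hxW, h, hh, hW⟩ := Riem.exists_isAdapted_nhds (n := 2) x
      obtain ⟨S, hxS, hSo, hS⟩ := (Riem.vol 2 M).exists_isOpen_measure_lt_top x
      exact ⟨W ∩ S, hWo.inter hSo, ⟨hxW, hxS⟩,
        measure_ne_top_of_subset inter_subset_right hS.ne, h, hh.mono inter_subset_left,
        fun f y hy => hW f y hy.1⟩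
  choose hUfin h hh hadapted using hU
  obtain ⟨L, hL, hLU, hLfin, hLd, hLε⟩ := Riem.exists_disjoint_closed_almost_cover
    (Riem.vol 2 M) hUo hcov hUfin (ENNReal.ofReal_pos.2 hε).ne'
  obtain ⟨f, hf, hfL⟩ := Riem.exists_contMDiff_eqOn_of_disjoint hL hUo hLU hLfin hLd hh
  have hfV : ∀ x ∈ ⋃ i, interior (L i), Riem.IsAdapted 2 f x := fun x hx => by
    obtain ⟨i, hi⟩ := mem_iUnion.1 hx
    exact hadapted i f x (hLU i (interior_subset hi))
      (((hfL i).mono interior_subset).eventuallyEq_of_mem (isOpen_interior.mem_nhds hi))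
  have hVo : IsOpen (⋃ i, interior (L i)) := isOpen_iUnion fun i => isOpen_interior
  refine ⟨f, ⋃ i, interior (L i), hf, hVo, ?_, ⟨1 / 8, 5 / 8, by norm_num, fun T _ u ut du hu =>
    Riem.multiplierInequality_of_isAdapted hf hVo hfV hu⟩, 1 / 2, by norm_num,
    fun x hx => (hfV x hx).2⟩
  rw [← union_compl_self (⋃ i, interior (L i))]
  exact (measure_union_le _ _).trans (by gcongr)
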